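/- Let $X,Y$ be finite-dimensional real Euclidean spaces, $A:X\to Y$ linear with adjoint $A^*$, $b\in Y$, $c\in X$, and let $K\subseteq Y$ be a closed convex cone with dual cone $K^*=\{y:\langle y,x\rangle\ge 0\ \forall x\in K\}$. A (nonempty) face of a convex set $C$ is a convex subset $F\subseteq C$ such that whenever $x_1,x_2\in C$ and the open segment $(x_1,x_2)$ meets $F$, both $x_1,x_2$ lie in $F$. Assume that $K$ is nice, i.e. $K^*+E^\perp$ is closed for every face $E$ of $K$, and that the problem $$(P)\qquad \sup\{\langle c,x\rangle : b-Ax\in K\}$$ is feasible. Say that a minimization problem has strong duality with $(P)$ if it is feasible exactly when $(P)$ is bounded above, and in that case the two optimal values agree and the minimization problem attains its value. Let $F_{\min}$, the minimal cone of $(P)$, be the unique face of $K$ that contains $b-Ax$ in its relative interior, where $x$ is any point in the relative interior of the feasible set of $(P)$. Let $L=\{y\in Y: A^*y=0,\ \langle b,y\rangle=0\}$, let $\ell_K$ be the number of faces in the longest chain of faces of $K$, and $\ell=\min\{\ell_K-1,\dim L\}$. For $u\in K^*$ let $\operatorname{dir}(u,K^*)=\{y: u+ty\in K^*\text{ for some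 }t>0\}$ and $\tan(u,K^*)=\operatorname{cl}\operatorname{dir}(u,K^*)\cap-\operatorname{cl}\operatorname{dir}(u,K^*)$. Let $\tan'(u,K^*)$ be any sets such that for all $u\in K^*$: (1) $\tan'(u,K^*)\subseteq\tan(u,K^*)$, and (2) for every $v\in\tan(u,K^*)$ there is $\lambda>0$ with $v\in\tan'(\lambda u,K^*)$. Consider the system $$(EXT')\qquad (u_0,v_0)=(0,0);\quad u_i\in K^*,\ v_i\in\tan'(u_{i-1},K^*)\ (i=1,\dots,\ell+1);\quad u_i+v_i\in L\ (i=1,\dots,\ell).$$ Then $F_{\min}$ is well defined, $$F_{\min}^*=\{u_{\ell+1}+v_{\ell+1} : (u_i,v_i)_{i=0}^{\ell+1}\text{ is feasible in }(EXT')\},$$ and for every $c \in X$ the extended dual $$\inf\{\langle b,u_{\ell+1}+v_{\ell+1}\rangle : A^*(u_{\ell+1}+v_{\ell+1})=c,\ (u_i,v_i)_{i=0}^{\ell+1}\text{ is feasible in }(EXT')\}$$ has strong duality with $(P)$. In particular, let $(P)$ be a feasible semidefinite program $\sup\{\sum_j c_jx_j : b-\sum_{j=1}^m x_ja_j\succeq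 0\}$ with symmetric $n\times n$ matrices $a_1,\dots,a_m,b$, and let $\ell=\min\{n,\ n(n+1)/2-\dim\operatorname{span}\{a_1,\dots,a_m,b\}\}$; if $a_1,\dots,a_m,b$ are linearly independent, then $\ell=\min\{n,\ n(n+1)/2-m-1\}$. With $\langle x,z\rangle=\sum_{i,j}x_{ij}z_{ij}$, the problem of minimizing $\langle b,u_{\ell+1}+v_{\ell+1}\rangle$ subject to $u_0=v_0=0$, and $$\langle a_j,u_{\ell+1}+v_{\ell+1}\rangle=c_j\ \ (j=1,\dots,m),$$ $$\langle a_j,u_i+v_i\rangle=0\ \ (j=1,\dots,m),\quad \langle b,u_i+v_i\rangle=0\ \ (i=1,\dots,\ell),$$ $$u_i\succeq0,\quad \begin{pmatrix}u_{i-1}&w_i\\ w_i^T&I\end{pmatrix}\succeq0,\quad v_i=w_i+w_i^T,\quad w_i\in\mathbb R^{n\times n}\ \ (i=1,\dots,\ell+1)$$ has strong duality with $(P)$. So does the problem (Ramana's dual) obtained from it by eliminating the variables $v_i$, that is, by writing $w_i+w_i^T$ for $v_i$ ($i\ge1$) throughout. -/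

import Mathlib

open Pointwise

noncomputable section

namespace ConicDuality

/-! ### Convex sets -/

/-- A (nonempty) face `F` of a set `C`: a convex subset of `C` such that, whenever an open segment
with endpoints in `C` meets `F`, its endpoints lie in `F`. -/
structure IsFace {V : Type*} [AddCommGroup V] [Module ℝ V] (C F : Set V) : Prop where
  nonempty : F.Nonempty
  convex : Convex ℝ F
  extreme : IsExtreme ℝ C F

/-- The set of feasible directions at `x` in `C`. -/
def feasDir {V : Type*} [AddCommGroup V] [Module ℝ V] (x : V) (C : Set V) : Set V :=
  {y | ∃ t : ℝ, 0 < t ∧ x + t • y ∈ C}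

/-- The tangent space at `x` in `C`: `cl dir(x, C) ∩ - cl dir(x, C)`. -/
def tangent {V : Type*} [AddCommGroup V] [Module ℝ V] [TopologicalSpace V]
    (x : V) (C : Set V) : Set V :=
  closure (feasDir x C) ∩ -closure (feasDir x C)

/-! ### Strong duality -/

/-- Strong duality between the maximization problem `sup {f x | x ∈ P}` (assumed feasible) and the
minimization problem `inf {g y | y ∈ D}`: the first is bounded iff the second is feasible, and when
this is the case, the optimal values agree and the second is attained. -/
def StrongDuality {α β : Type*} (P : Set α) (f : α → ℝ) (D : Set β) (g : β → ℝ) : Prop :=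
  (BddAbove (f '' P) ↔ D.Nonempty) ∧
    (BddAbove (f '' P) → D.Nonempty → ∃ val : ℝ, IsLUB (f '' P) val ∧ IsLeast (g '' D) val)

/-! ### Conic linear programs over a closed convex cone `K` -/

section Conic

variable {X Y : Type*} [NormedAddCommGroup X] [InnerProductSpace ℝ X] [FiniteDimensional ℝ X]
  [NormedAddCommGroup Y] [InnerProductSpace ℝ Y] [FiniteDimensional ℝ Y]

/-- The feasible set `{x | b - A x ∈ K}` of the primal problem. -/
def primalFeas (K : ProperCone ℝ Y) (A : X →ₗ[ℝ] Y) (b : Y) : Set X :=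
  {x | b - A x ∈ K}

/-- `K` is nice: `K^* + E^⊥` is closed for every face `E` of `K`. -/
def IsNice (K : ProperCone ℝ Y) : Prop :=
  ∀ E : Set Y, IsFace (K : Set Y) E →
    IsClosed ((ProperCone.innerDual (K : Set Y) : Set Y) +
      (((Submodule.span ℝ E)ᗮ : Submodule ℝ Y) : Set Y))

/-- `F` is the minimal cone: the face of `K` with `b - A x` in its relative interior, where
`x` is in the relative interior of the primal feasible set. -/
def IsMinimalCone (K : ProperCone ℝ Y) (A : X →ₗ[ℝ] Y) (b : Y) (F : Set Y) : Prop :=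
  IsFace (K : Set Y) F ∧
    ∃ x ∈ intrinsicInterior ℝ (primalFeas K A b), b - A x ∈ intrinsicInterior ℝ F

/-- The subspace `L`, the null space of `(A, b)^* : y ↦ (A^* y, ⟨b, y⟩)`. -/
def nullL (A : X →ₗ[ℝ] Y) (b : Y) : Submodule ℝ Y :=
  LinearMap.ker (LinearMap.adjoint A) ⊓ LinearMap.ker (innerₗ Y b)

/-- The length (number of members) of the longest chain of faces of `K`. -/
def faceChainLength (K : ProperCone ℝ Y) : ℕ∞ :=
  Set.chainHeight {F : Set Y | IsFace (K : Set Y) F} (fun F G => F ⊆ G)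

/-- `ℓ = min {ℓ_K - 1, dim L}`; the minimum is finite because `dim L` is. -/
def ell (K : ProperCone ℝ Y) (A : X →ₗ[ℝ] Y) (b : Y) : ℕ :=
  (min (faceChainLength K - 1) (Module.finrank ℝ (nullL A b) : ℕ∞)).toNat

/-- The two requirements on `tan'(·, K^*)`, here `T : u ↦ tan'(u, K^*)`. -/
structure IsTangentVariant (K : ProperCone ℝ Y) (T : Y → Set Y) : Prop where
  subset : ∀ u ∈ ProperCone.innerDual (K : Set Y),
    T u ⊆ tangent u (ProperCone.innerDual (K : Set Y) : Set Y)
  scale : ∀ u ∈ ProperCone.innerDual (K : Set Y),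
    ∀ v ∈ tangent u (ProperCone.innerDual (K : Set Y) : Set Y), ∃ t : ℝ, 0 < t ∧ v ∈ T (t • u)

/-- The feasible set of the extended system in the variables `(u_i, v_i)`, `i = 0, …, l + 1`,
with the sets `T u` playing the role of `tan'(u, K^*)`. -/
def extFeas (K : ProperCone ℝ Y) (A : X →ₗ[ℝ] Y) (b : Y) (T : Y → Set Y) (l : ℕ) :
    Set ((Fin (l + 2) → Y) × (Fin (l + 2) → Y)) :=
  {p | (p.1 0 = 0 ∧ p.2 0 = 0) ∧
    (∀ i : Fin (l + 1), p.1 i.succ ∈ ProperCone.innerDual (K : Set Y) ∧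
      p.2 i.succ ∈ T (p.1 i.castSucc)) ∧
    (∀ i : Fin l, p.1 i.succ.castSucc + p.2 i.succ.castSucc ∈ nullL A b)}

/-- The feasible set of the extended dual. -/
def extDualFeas (K : ProperCone ℝ Y) (A : X →ₗ[ℝ] Y) (b : Y) (c : X) (T : Y → Set Y) (l : ℕ) :
    Set ((Fin (l + 2) → Y) × (Fin (l + 2) → Y)) :=
  {p | p ∈ extFeas K A b T l ∧
    LinearMap.adjoint A (p.1 (Fin.last (l + 1)) + p.2 (Fin.last (l + 1))) = c}

end Conic

/-! ### Semidefinite programs -/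

section SDP

variable {n m : ℕ}

/-- The inner product `∑ i j, x i j * z i j` of matrices. -/
def matInner (x z : Matrix (Fin n) (Fin n) ℝ) : ℝ := ∑ i, ∑ j, x i j * z i j

/-- The feasible set of the semidefinite program with constraint `∑ j, x j • a j ⪯ b`. -/
def sdpFeas (a : Fin m → Matrix (Fin n) (Fin n) ℝ) (b : Matrix (Fin n) (Fin n) ℝ) :
    Set (Fin m → ℝ) :=
  {x | (b - ∑ j, x j • a j).PosSemidef}

/-- The variables of the extended dual: `u_i, v_i` for `i = 0, …, l + 1`, and matrices `w_i` for
`i = 1, …, l + 1`, where `w_i` is stored at the index `i - 1`. -/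
structure SDPDualVars (n l : ℕ) where
  u : Fin (l + 2) → Matrix (Fin n) (Fin n) ℝ
  v : Fin (l + 2) → Matrix (Fin n) (Fin n) ℝ
  w : Fin (l + 1) → Matrix (Fin n) (Fin n) ℝ

/-- The feasible set of the extended dual of the semidefinite program, without `β` variables. -/
structure SDPDualVars.IsFeasible {l : ℕ} (a : Fin m → Matrix (Fin n) (Fin n) ℝ)
    (b : Matrix (Fin n) (Fin n) ℝ) (c : Fin m → ℝ) (p : SDPDualVars n l) : Prop where
  objective : ∀ j, matInner (a j) (p.u (Fin.last (l + 1)) + p.v (Fin.last (l + 1))) = c j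
  null : ∀ i : Fin l,
    (∀ j, matInner (a j) (p.u i.succ.castSucc + p.v i.succ.castSucc) = 0) ∧
      matInner b (p.u i.succ.castSucc + p.v i.succ.castSucc) = 0
  psd : ∀ i : Fin (l + 1), (p.u i.succ).PosSemidef
  block : ∀ i : Fin (l + 1),
    (Matrix.fromBlocks (p.u i.castSucc) (p.w i) (p.w i).transpose 1).PosSemidef
  v_eq : ∀ i : Fin (l + 1), p.v i.succ = p.w i + (p.w i).transpose
  zero : p.u 0 = 0 ∧ p.v 0 = 0

/-- The variables of Ramana's dual: `u_i` for `i = 0, …, l + 1`, and `w_i` for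
`i = 1, …, l + 1`, where `w_i` is stored at the index `i - 1`. -/
structure RamanaVars (n l : ℕ) where
  u : Fin (l + 2) → Matrix (Fin n) (Fin n) ℝ
  w : Fin (l + 1) → Matrix (Fin n) (Fin n) ℝ

/-- The matrix `u_i + w_i + w_iᵀ`, with `i` shifted by one. -/
def RamanaVars.y {l : ℕ} (p : RamanaVars n l) (i : Fin (l + 1)) : Matrix (Fin n) (Fin n) ℝ :=
  p.u i.succ + (p.w i + (p.w i).transpose)

/-- The feasible set of Ramana's dual, in which the variables `v_i` are eliminated. -/
structure RamanaVars.IsFeasible {l : ℕ} (a : Fin m → Matrix (Fin n) (Fin n) ℝ)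
    (b : Matrix (Fin n) (Fin n) ℝ) (c : Fin m → ℝ) (p : RamanaVars n l) : Prop where
  objective : ∀ j, matInner (a j) (p.y (Fin.last l)) = c j
  null : ∀ i : Fin l,
    (∀ j, matInner (a j) (p.y i.castSucc) = 0) ∧ matInner b (p.y i.castSucc) = 0
  psd : ∀ i : Fin (l + 1), (p.u i.succ).PosSemidef
  block : ∀ i : Fin (l + 1),
    (Matrix.fromBlocks (p.u i.castSucc) (p.w i) (p.w i).transpose 1).PosSemidef
  zero : p.u 0 = 0

end SDP

end ConicDuality

end

set_option linter.unusedSectionVars false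

noncomputable section

namespace ConicDuality

open scoped RealInnerProductSpace

/-! ### Relative interiors -/

section RelativeInterior

variable {V : Type*} [NormedAddCommGroup V] [NormedSpace ℝ V]

/-! The engine is facial reduction. At `u` in the dual cone, the tangent space is the orthogonal
complement of the exposed face `K ∩ u^⊥` (`mem_tangent_iff`). So if `F_min ⊆ K ∩ u_{i-1}^⊥`, then
`v_i` vanishes on every slack, and `u_i + v_i ∈ L` does too, hence so does `u_i`: the exposed faces
never lose `F_min` (`IsReduction.subset_exposedFace`), and `u_{ℓ+1} + v_{ℓ+1}` always lies in
`F_min^*`.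

Conversely, while an exposed face `E` is larger than `F_min`, a theorem of the alternative
(`exists_reducing_direction`) gives `y ∈ L ∩ E^*` that is not zero on `E`. Niceness splits `y = u +
v` with `u ∈ K^*`, `v ∈ E^⊥`, and adding this pair to the accumulated one cuts `E` down to `E ∩
y^⊥`. Each cut lengthens a chain of faces and enlarges `L ∩ E^⊥`, so there are at most `ℓ` cuts.
Once `F_min` is exposed, niceness writes any element of `F_min^*` as `u + v` with `v` tangent;
rescaling backwards along the sequence replaces `tan` by `tan'`.

With `K` replaced by `F_min`, some slack is in the relative interior, so a conic extension theorem
yields an attained dual with no gap (`exists_dual_solution`).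

For semidefinite programs it remains to check that the psd cone is nice, that chains of its faces
have at most `n + 1` members, that `L` is the complement of the span of the data, and that the block
condition is an admissible `tan'`. -/

theorem mem_intrinsicInterior_iff_ball {s : Set V} {x : V} :
    x ∈ intrinsicInterior ℝ s ↔ x ∈ affineSpan ℝ s ∧
      ∃ ε : ℝ, 0 < ε ∧ ∀ y ∈ affineSpan ℝ s, dist y x < ε → y ∈ s := by
  rw [mem_intrinsicInterior]
  constructor
  · rintro ⟨y, hy, rfl⟩
    rw [mem_interior_iff_mem_nhds, Metric.mem_nhds_iff] at hy
    obtain ⟨ε, hε, hball⟩ := hy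
    exact ⟨y.2, ε, hε, fun z hz hd => hball (a := ⟨z, hz⟩) hd⟩
  · rintro ⟨hx, ε, hε, h⟩
    refine ⟨⟨x, hx⟩, ?_, rfl⟩
    rw [mem_interior_iff_mem_nhds, Metric.mem_nhds_iff]
    exact ⟨ε, hε, fun z hz => h z z.2 hz⟩

/-- A segment ending in a relative interior point can be prolonged within the set. -/
theorem exists_prolong_of_mem_intrinsicInterior {s : Set V} {x z : V}
    (hx : x ∈ intrinsicInterior ℝ s) (hz : z ∈ s) : ∃ t : ℝ, 0 < t ∧ x + t • (x - z) ∈ s := by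
  obtain ⟨hxs, ε, hε, h⟩ := mem_intrinsicInterior_iff_ball.1 hx
  have hpos : 0 < ‖x - z‖ + 1 := by positivity
  refine ⟨ε / (‖x - z‖ + 1), by positivity, h _ ?_ ?_⟩
  · have := AffineMap.lineMap_mem (-(ε / (‖x - z‖ + 1))) hxs (subset_affineSpan ℝ s hz)
    convert this using 1
    rw [AffineMap.lineMap_apply_module']
    module
  · rw [dist_eq_norm, add_sub_cancel_left, norm_smul, Real.norm_of_nonneg (by positivity),
      div_mul_eq_mul_div, div_lt_iff₀ hpos]
    nlinarith

/-- A point of a convex set towards which all segments can be prolonged is a relative interior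
point. -/
theorem mem_intrinsicInterior_of_prolong [FiniteDimensional ℝ V] {s : Set V} (hs : Convex ℝ s)
    {x : V} (hx : x ∈ s) (h : ∀ z ∈ s, ∃ t : ℝ, 0 < t ∧ x + t • (x - z) ∈ s) :
    x ∈ intrinsicInterior ℝ s := by
  obtain ⟨w, hw⟩ := Set.Nonempty.intrinsicInterior hs ⟨x, hx⟩
  obtain ⟨hwa, ε, hε, hball⟩ := mem_intrinsicInterior_iff_ball.1 hw
  obtain ⟨t, ht, hp⟩ := h w (intrinsicInterior_subset hw)
  have hxa := subset_affineSpan ℝ s hx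
  refine mem_intrinsicInterior_iff_ball.2 ⟨hxa, ε * (t / (1 + t)), by positivity, ?_⟩
  intro y hy hd
  have h1t : (1 + t) ≠ 0 := by positivity
  -- With `p = x + t • (x - w)`, the point `y` is the combination of this point and `p` with weights
  -- `t/(1+t)` and `1/(1+t)`; the radius was scaled so that this point stays in the ball about `w`.
  have hq : w + ((1 + t) / t) • (y - x) ∈ s := by
    apply hball
    · have := AffineSubspace.vadd_mem_of_mem_direction
        ((affineSpan ℝ s).direction.smul_mem ((1 + t) / t)
          (AffineSubspace.vsub_mem_direction hy hxa)) hwa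
      simpa [add_comm] using this
    · rw [dist_eq_norm, add_sub_cancel_left, norm_smul, Real.norm_of_nonneg (by positivity),
        ← dist_eq_norm]
      calc (1 + t) / t * dist y x < (1 + t) / t * (ε * (t / (1 + t))) := by gcongr
        _ = ε := by field_simp
  have := hs hq hp (a := t / (1 + t)) (b := 1 / (1 + t)) (by positivity) (by positivity)
    (by field_simp; ring)
  convert this using 1
  have e1 : (t / (1 + t)) * ((1 + t) / t) = 1 := by field_simp
  have e2 : (1 / (1 + t)) * t = t / (1 + t) := by ring
  have e3 : 1 / (1 + t) = 1 - t / (1 + t) := by field_simp; ring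
  rw [smul_add, smul_smul, e1, smul_add, smul_smul, e2, e3]
  module

end RelativeInterior

/-! ### Faces of closed convex cones -/

section Faces

variable {Y : Type*} [NormedAddCommGroup Y] [InnerProductSpace ℝ Y]
  {K : ProperCone ℝ Y} {E : Set Y}

theorem IsFace.subset (hE : IsFace (K : Set Y) E) : E ⊆ K := hE.extreme.subset

theorem cone_add_mem {x y : Y} (hx : x ∈ K) (hy : y ∈ K) : x + y ∈ K := K.add_mem hx hy

theorem IsFace.zero_mem (hE : IsFace (K : Set Y) E) : (0 : Y) ∈ E := by
  obtain ⟨x, hx⟩ := hE.nonempty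
  refine hE.extreme.left_mem_of_mem_openSegment K.zero_mem
    (K.smul_mem (hE.subset hx) zero_le_two) hx ⟨1 / 2, 1 / 2, by norm_num, by norm_num,
      by norm_num, ?_⟩
  module

theorem IsFace.smul_mem (hE : IsFace (K : Set Y) E) {x : Y} (hx : x ∈ E) {t : ℝ} (ht : 0 ≤ t) :
    t • x ∈ E := by
  rcases le_or_gt t 1 with h1 | h1
  · have := hE.convex hx hE.zero_mem ht (sub_nonneg.2 h1) (by ring)
    simpa using this
  · have h0 : t ≠ 0 := by positivity
    refine hE.extreme.left_mem_of_mem_openSegment (K.smul_mem (hE.subset hx) ht)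
      K.zero_mem hx ⟨t⁻¹, 1 - t⁻¹, by positivity, sub_pos.2 (inv_lt_one_of_one_lt₀ h1),
        by ring, ?_⟩
    simp [smul_smul, h0]

theorem IsFace.add_mem (hE : IsFace (K : Set Y) E) {x y : Y} (hx : x ∈ E) (hy : y ∈ E) :
    x + y ∈ E := by
  have := hE.smul_mem (hE.convex hx hy (a := 1 / 2) (b := 1 / 2) (by norm_num) (by norm_num)
    (by norm_num)) zero_le_two
  convert this using 1
  module

theorem IsFace.mem_of_add_mem (hE : IsFace (K : Set Y) E) {x y : Y} (hx : x ∈ K) (hy : y ∈ K)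
    (hxy : x + y ∈ E) : x ∈ E := by
  have : (2 : ℝ) • x ∈ E := by
    refine hE.extreme.left_mem_of_mem_openSegment (K.smul_mem hx zero_le_two)
      (K.smul_mem hy zero_le_two) hxy ⟨1 / 2, 1 / 2, by norm_num, by norm_num, by norm_num, ?_⟩
    module
  have := hE.smul_mem this (t := 1 / 2) (by norm_num)
  convert this using 1
  module

theorem IsFace.mem_of_smul_mem (hE : IsFace (K : Set Y) E) {x : Y} {t : ℝ} (ht : 0 < t)
    (hx : t • x ∈ E) : x ∈ E := by
  simpa [smul_smul, ht.ne'] using hE.smul_mem hx (t := t⁻¹) (by positivity)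

/-- `e` lies in the algebraic core of the cone `E`. -/
def IsCore (E : Set Y) (e : Y) : Prop :=
  e ∈ E ∧ ∀ z ∈ E, ∃ s : ℝ, 0 < s ∧ e - s • z ∈ E

/-- In a cone, `e + t(e - z) = (1+t)(e - (t/(1+t)) z)`, so prolonging past `e` and subtracting a
multiple of `z` are the same up to scaling. This makes relative interiors purely algebraic from here
on. -/
theorem IsFace.isCore_iff [FiniteDimensional ℝ Y] (hE : IsFace (K : Set Y) E) {e : Y} :
    IsCore E e ↔ e ∈ intrinsicInterior ℝ E := by
  constructor
  · rintro ⟨he, h⟩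
    refine mem_intrinsicInterior_of_prolong hE.convex he fun z hz => ?_
    obtain ⟨s, hs, hm⟩ := h z hz
    refine ⟨s, hs, ?_⟩
    convert hE.add_mem hm (hE.smul_mem he hs.le) using 1
    module
  · intro he
    refine ⟨intrinsicInterior_subset he, fun z hz => ?_⟩
    obtain ⟨t, ht, hm⟩ := exists_prolong_of_mem_intrinsicInterior he hz
    refine ⟨t / (1 + t), by positivity, hE.mem_of_smul_mem (t := 1 + t) (by positivity) ?_⟩
    convert hm using 1
    rw [smul_sub, smul_smul, mul_div_cancel₀ _ (by positivity)]
    module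

theorem IsFace.exists_isCore [FiniteDimensional ℝ Y] (hE : IsFace (K : Set Y) E) :
    ∃ e, IsCore E e := by
  obtain ⟨e, he⟩ := Set.Nonempty.intrinsicInterior hE.convex hE.nonempty
  exact ⟨e, hE.isCore_iff.2 he⟩

/-- The splitting `e = s z + (e - s z)` has both terms in `K`, so a face that contains `e` absorbs
`z`. -/
theorem IsFace.subset_of_isCore {F : Set Y} (hE : IsFace (K : Set Y) E) (hF : F ⊆ K) {e : Y}
    (he : IsCore F e) (heE : e ∈ E) : F ⊆ E := by
  intro z hz
  obtain ⟨s, hs, hm⟩ := he.2 z hz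
  refine hE.mem_of_smul_mem hs (hE.mem_of_add_mem (K.smul_mem (hF hz) hs.le) (hF hm) ?_)
  simpa using heE

/-- The smallest face of the cone `K` that contains a given point of `K`. -/
def minFace (K : ProperCone ℝ Y) (y : Y) : Set Y :=
  {z | z ∈ K ∧ ∃ s : ℝ, 0 < s ∧ y - s • z ∈ K}

theorem isFace_minFace {y : Y} (hy : y ∈ K) : IsFace (K : Set Y) (minFace K y) := by
  have key : ∀ {z : Y} {s t : ℝ}, z ∈ K → t ≤ s → y - s • z ∈ K → y - t • z ∈ K := by
    intro z s t hz hts h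
    convert cone_add_mem h (K.smul_mem hz (sub_nonneg.2 hts)) using 1
    module
  refine ⟨⟨y, hy, 1, one_pos, by simp⟩, ?_, ⟨fun z hz => hz.1, ?_⟩⟩
  · rintro z₁ ⟨hz₁, s₁, hs₁, h₁⟩ z₂ ⟨hz₂, s₂, hs₂, h₂⟩ a b ha hb hab
    refine ⟨K.convex hz₁ hz₂ ha hb hab, min s₁ s₂, lt_min hs₁ hs₂, ?_⟩
    convert cone_add_mem (K.smul_mem (key hz₁ (min_le_left s₁ s₂) h₁) ha)
      (K.smul_mem (key hz₂ (min_le_right s₁ s₂) h₂) hb) using 1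
    obtain rfl : b = 1 - a := by linarith
    module
  · rintro z₁ hz₁ z₂ hz₂ z ⟨hz, s, hs, h⟩ ⟨a, b, ha, hb, hab, rfl⟩
    refine ⟨hz₁, s * a, by positivity, ?_⟩
    convert cone_add_mem h (K.smul_mem hz₂ (mul_nonneg hs.le hb.le)) using 1
    module

theorem isCore_minFace {y : Y} (hy : y ∈ K) : IsCore (minFace K y) y := by
  refine ⟨⟨hy, 1, one_pos, by simp⟩, ?_⟩
  rintro z ⟨hz, s, hs, h⟩
  refine ⟨s, hs, h, 1, one_pos, ?_⟩
  simpa using K.smul_mem hz hs.le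

end Faces

/-! ### The minimal cone -/

section MinimalCone

variable {X Y : Type*} [NormedAddCommGroup X] [InnerProductSpace ℝ X] [FiniteDimensional ℝ X]
  [NormedAddCommGroup Y] [InnerProductSpace ℝ Y] [FiniteDimensional ℝ Y]
  {K : ProperCone ℝ Y} {A : X →ₗ[ℝ] Y} {b : Y} {F : Set Y}

theorem convex_primalFeas (K : ProperCone ℝ Y) (A : X →ₗ[ℝ] Y) (b : Y) :
    Convex ℝ (primalFeas K A b) := by
  intro x hx z hz s t hs ht hst
  change b - A (s • x + t • z) ∈ K
  convert cone_add_mem (K.smul_mem hx hs) (K.smul_mem hz ht) using 1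
  obtain rfl : t = 1 - s := by linarith
  rw [map_add, map_smul, map_smul]
  module

/-- Prolong the segment from `x` past the relative interior point `x₀`: a positive multiple of the
slack at `x₀` is then the sum of a multiple of the slack at `x` and another slack, and the face
absorbs both. -/
theorem IsMinimalCone.slack_mem (hF : IsMinimalCone K A b F) {x : X}
    (hx : x ∈ primalFeas K A b) : b - A x ∈ F := by
  obtain ⟨hface, x₀, hx₀, hs₀⟩ := hF
  obtain ⟨t, ht, hm⟩ := exists_prolong_of_mem_intrinsicInterior hx₀ hx
  refine hface.mem_of_smul_mem ht (hface.mem_of_add_mem (K.smul_mem hx ht.le) hm ?_)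
  convert hface.smul_mem (intrinsicInterior_subset hs₀) (t := 1 + t) (by positivity) using 1
  simp only [map_add, map_smul, map_sub]
  module

theorem IsMinimalCone.exists_isCore (hF : IsMinimalCone K A b F) :
    ∃ x ∈ primalFeas K A b, IsCore F (b - A x) := by
  obtain ⟨hface, x₀, hx₀, hs₀⟩ := hF
  exact ⟨x₀, intrinsicInterior_subset hx₀, hface.isCore_iff.2 hs₀⟩

theorem IsMinimalCone.subset_face {E : Set Y} (hF : IsMinimalCone K A b F)
    (hE : IsFace (K : Set Y) E) (h : ∀ x ∈ primalFeas K A b, b - A x ∈ E) : F ⊆ E := by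
  obtain ⟨x, hx, hc⟩ := hF.exists_isCore
  exact hE.subset_of_isCore hF.1.subset hc (h x hx)

theorem existsUnique_isMinimalCone (h : (primalFeas K A b).Nonempty) :
    ∃! F : Set Y, IsMinimalCone K A b F := by
  obtain ⟨x, hx⟩ := Set.Nonempty.intrinsicInterior (convex_primalFeas K A b) h
  have hs : x ∈ primalFeas K A b := intrinsicInterior_subset hx
  refine ⟨minFace K (b - A x), ⟨isFace_minFace hs, x, hx,
    (isFace_minFace hs).isCore_iff.1 (isCore_minFace hs)⟩, fun F hF => ?_⟩
  refine (hF.subset_face (isFace_minFace hs) ?_).antisymm ?_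
  · intro z hz
    obtain ⟨t, ht, hm⟩ := exists_prolong_of_mem_intrinsicInterior hx hz
    refine ⟨hz, t / (1 + t), by positivity, ?_⟩
    convert K.smul_mem hm (r := (1 + t)⁻¹) (by positivity) using 1
    have h1 : 1 - t / (1 + t) = (1 + t)⁻¹ := by field_simp; ring
    simp only [map_add, map_smul, map_sub]
    rw [div_eq_inv_mul, mul_smul]
    have h2 : b - A x = (1 + t)⁻¹ • ((1 + t) • (b - A x)) := by
      rw [smul_smul, inv_mul_cancel₀ (by positivity), one_smul]
    rw [h2]
    module
  · exact hF.1.subset_of_isCore (isFace_minFace hs).subset (isCore_minFace hs)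
      (hF.slack_mem hs)

end MinimalCone

/-! ### Tangent spaces and dual cones of faces -/

section Tangent

theorem nonpos_of_forall_mul_le {a B : ℝ} (h : ∀ t : ℝ, 0 < t → t * a ≤ B) : a ≤ 0 := by
  by_contra! ha
  have := h ((|B| + 1) / a) (by positivity)
  rw [div_mul_cancel₀ _ ha.ne'] at this
  linarith [le_abs_self B]

variable {Y : Type*} [NormedAddCommGroup Y] [InnerProductSpace ℝ Y] [FiniteDimensional ℝ Y]
  {K : ProperCone ℝ Y} {E : Set Y}

theorem exists_separating_of_notMem_closure {S : Set Y} (hS : Convex ℝ S) (h0 : (0 : Y) ∈ S)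
    (hsmul : ∀ a ∈ S, ∀ t : ℝ, 0 < t → t • a ∈ S) {x : Y} (hx : x ∉ closure S) :
    ∃ z : Y, (∀ a ∈ S, 0 ≤ ⟪z, a⟫) ∧ ⟪z, x⟫ < 0 := by
  obtain ⟨f, r, hf, hr⟩ := geometric_hahn_banach_closed_point hS.closure isClosed_closure hx
  have hfz : ∀ a, ⟪-(InnerProductSpace.toDual ℝ Y).symm f, a⟫ = - f a := fun a => by
    rw [inner_neg_left, InnerProductSpace.toDual_symm_apply]
  refine ⟨-(InnerProductSpace.toDual ℝ Y).symm f, fun a ha => ?_, ?_⟩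
  · rw [hfz, neg_nonneg]
    refine nonpos_of_forall_mul_le (B := r) fun t ht => ?_
    simpa using (hf _ (subset_closure (hsmul a ha t ht))).le
  · rw [hfz, neg_lt_zero]
    have := hf 0 (subset_closure h0)
    rw [map_zero] at this
    exact this.trans hr

theorem mem_of_forall_innerDual {x : Y} (h : ∀ y ∈ ProperCone.innerDual (K : Set Y), 0 ≤ ⟪y, x⟫) :
    x ∈ K := by
  rw [← ProperCone.innerDual_innerDual K]
  exact fun y hy => h y hy

theorem inner_nonneg_of_mem_innerDual {u z : Y} (hu : u ∈ ProperCone.innerDual (K : Set Y))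
    (hz : z ∈ K) : 0 ≤ ⟪u, z⟫ := by
  rw [real_inner_comm]
  exact hu hz

/-- The face of `K` exposed by `u`. -/
def exposedFace (K : ProperCone ℝ Y) (u : Y) : Set Y := {z | z ∈ K ∧ ⟪u, z⟫ = 0}

theorem isFace_exposedFace {u : Y} (hu : u ∈ ProperCone.innerDual (K : Set Y)) :
    IsFace (K : Set Y) (exposedFace K u) := by
  refine ⟨⟨0, K.zero_mem, inner_zero_right u⟩, ?_, ⟨fun z hz => hz.1, ?_⟩⟩
  · rintro x ⟨hx, hx'⟩ y ⟨hy, hy'⟩ a b ha hb hab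
    refine ⟨K.convex hx hy ha hb hab, ?_⟩
    simp [inner_add_right, inner_smul_right, hx', hy']
  · rintro x hx y hy z ⟨hz, hz'⟩ ⟨a, b, ha, hb, hab, rfl⟩
    refine ⟨hx, ?_⟩
    rw [inner_add_right, inner_smul_right, inner_smul_right] at hz'
    have h1 := inner_nonneg_of_mem_innerDual hu hx
    have h2 := inner_nonneg_of_mem_innerDual hu hy
    have h3 := mul_nonneg ha.le h1
    have h4 := mul_nonneg hb.le h2
    have : a * ⟪u, x⟫ = 0 := by linarith
    simpa [ha.ne'] using this

/-- Homogeneity moves the scaling from `y` to `u`, with `s = 1/t`; in this form the feasible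
directions visibly form a convex cone. -/
theorem mem_feasDir_iff {D : ProperCone ℝ Y} {u y : Y} :
    y ∈ feasDir u (D : Set Y) ↔ ∃ s : ℝ, 0 < s ∧ s • u + y ∈ D := by
  constructor
  · rintro ⟨t, ht, h⟩
    refine ⟨t⁻¹, by positivity, ?_⟩
    convert D.smul_mem h (r := t⁻¹) (by positivity) using 1
    simp [smul_smul, ht.ne']
  · rintro ⟨s, hs, h⟩
    refine ⟨s⁻¹, by positivity, ?_⟩
    have := D.smul_mem h (r := s⁻¹) (by positivity)
    simpa [smul_smul, hs.ne'] using this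

/-- The tangent space at a point of the dual cone is the orthogonal complement of the face that
the point exposes. -/
theorem mem_tangent_iff {u v : Y} (hu : u ∈ ProperCone.innerDual (K : Set Y)) :
    v ∈ tangent u (ProperCone.innerDual (K : Set Y) : Set Y) ↔
      ∀ z ∈ exposedFace K u, ⟪v, z⟫ = 0 := by
  set D := ProperCone.innerDual (K : Set Y) with hD
  have hle : ∀ z ∈ exposedFace K u, ∀ y ∈ closure (feasDir u (D : Set Y)), 0 ≤ ⟪y, z⟫ := by
    intro z hz y hy
    refine closure_minimal (t := {y : Y | 0 ≤ ⟪y, z⟫}) ?_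
      (isClosed_le continuous_const (continuous_id.inner continuous_const)) hy
    intro y hy
    obtain ⟨s, hs, h⟩ := mem_feasDir_iff.1 hy
    have := inner_nonneg_of_mem_innerDual h hz.1
    rwa [inner_add_left, inner_smul_left, hz.2, mul_zero, zero_add] at this
  have hmem : ∀ w : Y, (∀ z ∈ exposedFace K u, ⟪w, z⟫ = 0) →
      w ∈ closure (feasDir u (D : Set Y)) := by
    intro w hw
    by_contra hcl
    have h0 : (0 : Y) ∈ feasDir u (D : Set Y) := mem_feasDir_iff.2 ⟨1, one_pos, by simpa using hu⟩
    have hconv : Convex ℝ (feasDir u (D : Set Y)) := by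
      intro x hx y hy a c ha hc hac
      obtain ⟨s, hs, h⟩ := mem_feasDir_iff.1 hx
      obtain ⟨t, ht, h'⟩ := mem_feasDir_iff.1 hy
      refine mem_feasDir_iff.2 ⟨a * s + c * t, ?_, ?_⟩
      · rcases ha.eq_or_lt with rfl | ha'
        · have : c = 1 := by linarith
          simp [this, ht]
        · positivity
      · convert cone_add_mem (D.smul_mem h ha) (D.smul_mem h' hc) using 1
        module
    have hsmul : ∀ y ∈ feasDir u (D : Set Y), ∀ t : ℝ, 0 < t → t • y ∈ feasDir u (D : Set Y) := by
      intro y hy t ht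
      obtain ⟨s, hs, h⟩ := mem_feasDir_iff.1 hy
      refine mem_feasDir_iff.2 ⟨t * s, by positivity, ?_⟩
      convert D.smul_mem h ht.le using 1
      module
    -- The feasible directions contain the whole dual cone and `-u`. So the separator `z` is in `K`
    -- by biduality and is orthogonal to `u`; it lies in the exposed face, where `w` vanishes.
    obtain ⟨z, hz, hzw⟩ := exists_separating_of_notMem_closure hconv h0 hsmul hcl
    have hzK : z ∈ K := by
      refine mem_of_forall_innerDual fun y hy => ?_
      rw [real_inner_comm]
      exact hz y (mem_feasDir_iff.2 ⟨1, one_pos, cone_add_mem (D.smul_mem hu zero_le_one) hy⟩)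
    have hzu : ⟪u, z⟫ ≤ 0 := by
      have := hz (-u) (mem_feasDir_iff.2 ⟨1, one_pos, by simp⟩)
      rw [inner_neg_right, real_inner_comm] at this
      linarith
    have := hw z ⟨hzK, le_antisymm hzu (inner_nonneg_of_mem_innerDual hu hzK)⟩
    rw [real_inner_comm] at this
    exact hzw.ne this
  constructor
  · rintro ⟨h₁, h₂⟩ z hz
    have := hle z hz _ h₂
    rw [inner_neg_left] at this
    linarith [hle z hz _ h₁]
  · exact fun h => ⟨hmem v h, hmem (-v) fun z hz => by rw [inner_neg_left, h z hz, neg_zero]⟩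

theorem IsFace.exists_sub_of_mem_span (hE : IsFace (K : Set Y) E) {z : Y}
    (hz : z ∈ Submodule.span ℝ E) : ∃ x ∈ E, ∃ y ∈ E, z = x - y := by
  induction hz using Submodule.span_induction with
  | mem x hx => exact ⟨x, hx, 0, hE.zero_mem, by simp⟩
  | zero => exact ⟨0, hE.zero_mem, 0, hE.zero_mem, by simp⟩
  | add x y _ _ hx hy =>
    obtain ⟨a, ha, b, hb, rfl⟩ := hx
    obtain ⟨c, hc, d, hd, rfl⟩ := hy
    exact ⟨a + c, hE.add_mem ha hc, b + d, hE.add_mem hb hd, by abel⟩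
  | smul r x _ hx =>
    obtain ⟨a, ha, b, hb, rfl⟩ := hx
    rcases le_total 0 r with hr | hr
    · exact ⟨r • a, hE.smul_mem ha hr, r • b, hE.smul_mem hb hr, by module⟩
    · exact ⟨(-r) • b, hE.smul_mem hb (by linarith), (-r) • a, hE.smul_mem ha (by linarith),
        by module⟩

theorem mem_span_orthogonal_iff {S : Set Y} {v : Y} :
    v ∈ (Submodule.span ℝ S)ᗮ ↔ ∀ z ∈ S, ⟪v, z⟫ = 0 := by
  rw [Submodule.mem_orthogonal']
  refine ⟨fun h z hz => h z (Submodule.subset_span hz), fun h z hz => ?_⟩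
  induction hz using Submodule.span_induction with
  | mem x hx => exact h x hx
  | zero => simp
  | add x y _ _ hx hy => rw [inner_add_right, hx, hy, add_zero]
  | smul r x _ hx => rw [inner_smul_right, hx, mul_zero]

/-- Over a nice cone, the dual of a face is the sum of the dual cone and the orthogonal complement
of the face. -/
theorem IsNice.exists_add_of_mem_innerDual (hK : IsNice K) (hE : IsFace (K : Set Y) E) {y : Y}
    (hy : y ∈ ProperCone.innerDual E) :
    ∃ u ∈ ProperCone.innerDual (K : Set Y), ∃ v : Y, (∀ z ∈ E, ⟪v, z⟫ = 0) ∧ y = u + v := by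
  set D := ProperCone.innerDual (K : Set Y) with hD
  set W := (Submodule.span ℝ E)ᗮ with hW
  suffices y ∈ (D : Set Y) + (W : Set Y) by
    obtain ⟨u, hu, v, hv, rfl⟩ := this
    exact ⟨u, hu, v, mem_span_orthogonal_iff.1 hv, rfl⟩
  -- The only use of niceness: the sum is closed, so a vector outside it can be strictly separated.
  rw [← (hK E hE).closure_eq]
  by_contra hcl
  have hsmul : ∀ a ∈ (D : Set Y) + (W : Set Y), ∀ t : ℝ, 0 < t →
      t • a ∈ (D : Set Y) + (W : Set Y) := by
    rintro _ ⟨u, hu, v, hv, rfl⟩ t ht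
    exact ⟨t • u, D.smul_mem hu ht.le, t • v, W.smul_mem t hv, by simp⟩
  obtain ⟨z, hz, hzy⟩ := exists_separating_of_notMem_closure
    (D.convex.add W.convex) ⟨0, D.zero_mem, 0, W.zero_mem, by simp⟩ hsmul hcl
  have hzK : z ∈ K := by
    refine mem_of_forall_innerDual fun u hu => ?_
    rw [real_inner_comm]
    exact hz u ⟨u, hu, 0, W.zero_mem, by simp⟩
  have hzW : z ∈ Wᗮ := by
    rw [Submodule.mem_orthogonal']
    intro w hw
    have h1 := hz w ⟨0, D.zero_mem, w, hw, by simp⟩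
    have h2 := hz (-w) ⟨0, D.zero_mem, -w, W.neg_mem hw, by simp⟩
    rw [inner_neg_right] at h2
    linarith
  rw [hW, Submodule.orthogonal_orthogonal] at hzW
  obtain ⟨a, ha, b, hb, rfl⟩ := hE.exists_sub_of_mem_span hzW
  -- `K ∩ span E = E`: the face contains `a = (a - b) + b`, and both terms are in `K`.
  have hab : a - b ∈ E := hE.mem_of_add_mem hzK (hE.subset hb) (by simpa using ha)
  exact hzy.not_ge (hy hab)

end Tangent

/-! ### Facial reduction -/

section FacialReduction

variable {X Y : Type*} [NormedAddCommGroup X] [InnerProductSpace ℝ X] [FiniteDimensional ℝ X]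
  [NormedAddCommGroup Y] [InnerProductSpace ℝ Y] [FiniteDimensional ℝ Y]
  {K : ProperCone ℝ Y} {A : X →ₗ[ℝ] Y} {b : Y} {F : Set Y}

theorem mem_nullL_iff {y : Y} : y ∈ nullL A b ↔ (∀ x, ⟪y, A x⟫ = 0) ∧ ⟪y, b⟫ = 0 := by
  rw [nullL, Submodule.mem_inf, LinearMap.mem_ker, LinearMap.mem_ker, innerₗ_apply_apply,
    real_inner_comm]
  refine and_congr_left fun _ => ?_
  rw [← inner_self_eq_zero (𝕜 := ℝ)]
  constructor
  · intro h x
    rw [inner_self_eq_zero] at h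
    rw [← LinearMap.adjoint_inner_left, h, inner_zero_left]
  · intro h
    rw [LinearMap.adjoint_inner_left, h]

/-- If every element of `L ∩ E^*` vanished on `E`, then, with `e` in the core of `E`, separating
`-e` from `E + L^⊥` would be impossible; hence `e + z` would lie in `L^⊥ = span{b} + range A` for
some `z ∈ E`. Correcting it by a feasible slack puts `e` in `F`, and then `E ⊆ F`. -/
theorem exists_reducing_direction (hF : IsMinimalCone K A b F) {E : Set Y}
    (hE : IsFace (K : Set Y) E) (hFE : F ⊂ E) :
    ∃ y ∈ nullL A b, (∀ z ∈ E, 0 ≤ ⟪y, z⟫) ∧ ∃ z ∈ E, ⟪y, z⟫ ≠ 0 := by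
  by_contra! hno
  obtain ⟨e, he⟩ := hE.exists_isCore
  obtain ⟨x₀, hx₀, hs₀⟩ := hF.exists_isCore
  let N : Submodule ℝ Y := Submodule.span ℝ {b} ⊔ LinearMap.range A
  let W : Submodule ℝ Y := nullL A b ⊓ (Submodule.span ℝ E)ᗮ
  have hN : ∀ y, (∀ n ∈ N, ⟪y, n⟫ = 0) ↔ y ∈ nullL A b := by
    intro y
    rw [mem_nullL_iff]
    refine ⟨fun h => ⟨fun x => h _ (Submodule.mem_sup_right ⟨x, rfl⟩),
      h _ (Submodule.mem_sup_left (Submodule.mem_span_singleton_self b))⟩, ?_⟩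
    rintro ⟨h₁, h₂⟩ n hn
    obtain ⟨p, hp, q, ⟨x, rfl⟩, rfl⟩ := Submodule.mem_sup.1 hn
    obtain ⟨t, rfl⟩ := Submodule.mem_span_singleton.1 hp
    rw [inner_add_right, inner_smul_right, h₁, h₂, mul_zero, add_zero]
  -- `N` is the complement of `L`. Adding `W = L ∩ E^⊥` makes `C` span the space, so it has interior
  -- and the separation below is strict at an interior point.
  let C : Set Y := E + ((N ⊔ W : Submodule ℝ Y) : Set Y)
  have hC : Convex ℝ C := hE.convex.add (Submodule.convex _)
  have hEC : E ⊆ C := fun z hz => ⟨z, hz, 0, Submodule.zero_mem _, by simp⟩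
  have hNC : ((N ⊔ W : Submodule ℝ Y) : Set Y) ⊆ C := fun z hz => ⟨0, hE.zero_mem, z, hz, by simp⟩
  have hspan : Submodule.span ℝ C = ⊤ := by
    rw [← Submodule.orthogonal_eq_bot_iff, Submodule.eq_bot_iff]
    intro y hy
    rw [mem_span_orthogonal_iff] at hy
    have hyW : y ∈ W := ⟨(hN y).1 fun n hn => hy n (hNC (Submodule.mem_sup_left hn)),
      mem_span_orthogonal_iff.2 fun z hz => hy z (hEC hz)⟩
    exact inner_self_eq_zero.1 (hy y (hNC (Submodule.mem_sup_right hyW)))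
  have h0C : (0 : Y) ∈ C := hEC hE.zero_mem
  have hint : (interior C).Nonempty := by
    rw [hC.interior_nonempty_iff_affineSpan_eq_top,
      AffineSubspace.affineSpan_eq_top_iff_vectorSpan_eq_top_of_nonempty ℝ Y Y ⟨0, h0C⟩,
      vectorSpan_eq_span_vsub_set_right ℝ h0C]
    simpa using hspan
  by_cases hmem : -e ∈ C
  · obtain ⟨z, hz, n, hn, hzn⟩ := hmem
    obtain ⟨n', hn', w, hw, rfl⟩ := Submodule.mem_sup.1 hn
    have hw0 : w = 0 := by
      have h1 : ⟪w, z + (n' + w)⟫ = ⟪w, -e⟫ := congrArg _ hzn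
      have h2 := mem_span_orthogonal_iff.1 hw.2
      rw [inner_add_right, inner_add_right, (hN w).2 hw.1 n' hn', inner_neg_right, h2 z hz,
        h2 e he.1] at h1
      exact (inner_self_eq_zero (𝕜 := ℝ)).1 (by simpa using h1)
    obtain ⟨p, hp, q, ⟨x, rfl⟩, rfl⟩ := Submodule.mem_sup.1 hn'
    obtain ⟨t, rfl⟩ := Submodule.mem_span_singleton.1 hp
    have hez : e + z = -(t • b + A x) := by
      simp only [hw0, add_zero] at hzn
      rw [← neg_neg e, ← hzn]
      abel
    -- The coefficient of `b` in `e + z` is `-t`, of unknown sign; adding `β` times a slack makes it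
    -- positive, and dividing by it gives a feasible point.
    set β := |t| + 1
    have hβ : 0 < β + -t := by linarith [le_abs_self t]
    have hβ0 : 0 < β := by positivity
    have hsum : e + z + β • (b - A x₀) =
        (β + -t) • (b - A ((β + -t)⁻¹ • (x + β • x₀))) := by
      rw [hez, map_smul, smul_sub (β + -t), smul_smul, mul_inv_cancel₀ hβ.ne', map_add, map_smul]
      module
    have hK : e + z + β • (b - A x₀) ∈ K :=
      cone_add_mem (cone_add_mem (hE.subset he.1) (hE.subset hz)) (K.smul_mem hx₀ hβ0.le)
    have hP : (β + -t)⁻¹ • (x + β • x₀) ∈ primalFeas K A b := by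
      have := K.smul_mem hK (r := (β + -t)⁻¹) (by positivity)
      rwa [hsum, smul_smul, inv_mul_cancel₀ hβ.ne', one_smul] at this
    have hmF : e + z + β • (b - A x₀) ∈ F := by
      rw [hsum]
      exact hF.1.smul_mem (hF.slack_mem hP) hβ.le
    rw [add_assoc] at hmF
    have heF := hF.1.mem_of_add_mem (hE.subset he.1)
      (cone_add_mem (hE.subset hz) (K.smul_mem hx₀ hβ0.le)) hmF
    exact hFE.2 (hF.1.subset_of_isCore hE.subset he heF)
  · obtain ⟨f, hf⟩ := geometric_hahn_banach_open_point hC.interior isOpen_interior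
      (fun h => hmem (interior_subset h))
    have hle : ∀ c ∈ C, f c ≤ f (-e) := by
      intro c hc
      have : c ∈ closure (interior C) := by
        rw [hC.closure_interior_eq_closure_of_nonempty_interior hint]
        exact subset_closure hc
      exact closure_minimal (t := {a | f a ≤ f (-e)}) (fun a ha => (hf a ha).le)
        (isClosed_le f.continuous continuous_const) this
    have hfE : ∀ z ∈ E, f z ≤ 0 := fun z hz => nonpos_of_forall_mul_le (B := f (-e))
      fun t ht => by simpa using hle _ (hEC (hE.smul_mem hz ht.le))
    have hfN : ∀ n ∈ N ⊔ W, f n = 0 := by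
      have hle0 : ∀ n ∈ N ⊔ W, f n ≤ 0 := fun n hn => nonpos_of_forall_mul_le (B := f (-e))
        fun t ht => by simpa using hle _ (hNC (Submodule.smul_mem _ t hn))
      intro n hn
      have := hle0 _ (Submodule.neg_mem _ hn)
      rw [map_neg] at this
      linarith [hle0 n hn]
    set y := -(InnerProductSpace.toDual ℝ Y).symm f
    have hfy : ∀ a, ⟪y, a⟫ = - f a := fun a => by
      rw [inner_neg_left, InnerProductSpace.toDual_symm_apply]
    have hy0 := hno y ((hN y).1 fun n hn => by
      rw [hfy, hfN n (Submodule.mem_sup_left hn), neg_zero])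
      fun z hz => by rw [hfy]; linarith [hfE z hz]
    -- By assumption `y` vanishes on all of `E`, so `f` is zero both at `-e` and at this interior
    -- point, against strict separation.
    obtain ⟨c, hc⟩ := hint
    obtain ⟨z, hz, n, hn, rfl⟩ := interior_subset hc
    have h1 := hf _ hc
    have h2 := hy0 z hz
    have h3 := hy0 e he.1
    rw [hfy] at h2 h3
    rw [map_add, hfN n hn, map_neg] at h1
    linarith

end FacialReduction

/-! ### Facial reduction sequences -/

section ReductionSequences

variable {X Y : Type*} [NormedAddCommGroup X] [InnerProductSpace ℝ X] [FiniteDimensional ℝ X]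
  [NormedAddCommGroup Y] [InnerProductSpace ℝ Y] [FiniteDimensional ℝ Y]
  {K : ProperCone ℝ Y} {A : X →ₗ[ℝ] Y} {b : Y} {F : Set Y} {T : Y → Set Y}

/-- `u` is the member `u_k` of some sequence `(u_i, v_i)`, `i ≤ k`, that satisfies the constraints
of the extended system. -/
def IsReduction (K : ProperCone ℝ Y) (A : X →ₗ[ℝ] Y) (b : Y) (T : Y → Set Y) : ℕ → Y → Prop
  | 0, u => u = 0
  | k + 1, u => ∃ u' v, IsReduction K A b T k u' ∧ u ∈ ProperCone.innerDual (K : Set Y) ∧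
      v ∈ T u' ∧ u + v ∈ nullL A b

/-- The tangent spaces of the dual cone, as a set-valued map. -/
def dualTangent (K : ProperCone ℝ Y) (u : Y) : Set Y :=
  tangent u (ProperCone.innerDual (K : Set Y) : Set Y)

theorem IsReduction.mem_innerDual {k : ℕ} {u : Y} (h : IsReduction K A b T k u) :
    u ∈ ProperCone.innerDual (K : Set Y) := by
  cases k with
  | zero => rw [show u = 0 from h]; exact (ProperCone.innerDual (K : Set Y)).zero_mem
  | succ k =>
    obtain ⟨u', v, _, hu, _⟩ := h
    exact hu

theorem IsReduction.mono {T' : Y → Set Y}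
    (hT : ∀ u ∈ ProperCone.innerDual (K : Set Y), T u ⊆ T' u) {k : ℕ} {u : Y}
    (h : IsReduction K A b T k u) : IsReduction K A b T' k u := by
  induction k generalizing u with
  | zero => exact h
  | succ k ih =>
    obtain ⟨u', v, h', hu, hv, hL⟩ := h
    exact ⟨u', v, ih h', hu, hT u' h'.mem_innerDual hv, hL⟩

theorem smul_mem_dualTangent {u v : Y} (hu : u ∈ ProperCone.innerDual (K : Set Y))
    (hv : v ∈ dualTangent K u) (t : ℝ) : t • v ∈ dualTangent K u := by
  refine (mem_tangent_iff hu).2 fun z hz => ?_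
  rw [inner_smul_left, (mem_tangent_iff hu).1 hv z hz, mul_zero]

/-- The other constraints are conic, so scales can be chosen backwards: the scale `t` of the last
pair dictates, through the second axiom, a scale `r` for its predecessor. -/
theorem IsReduction.scale (hT : IsTangentVariant K T) {k : ℕ} {u : Y}
    (h : IsReduction K A b (dualTangent K) k u) {t : ℝ} (ht : 0 < t) :
    IsReduction K A b T k (t • u) := by
  induction k generalizing u t with
  | zero => rw [show u = 0 from h]; exact smul_zero t
  | succ k ih =>
    obtain ⟨u', v, h', hu, hv, hL⟩ := h
    obtain ⟨r, hr, hvr⟩ := hT.scale u' h'.mem_innerDual _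
      (smul_mem_dualTangent h'.mem_innerDual hv t)
    refine ⟨r • u', t • v, ih h' hr, (ProperCone.innerDual (K : Set Y)).smul_mem hu ht.le, hvr, ?_⟩
    rw [← smul_add]
    exact Submodule.smul_mem _ t hL

/-- Shorter sequences are padded with zeros at the front, not at the end. -/
theorem IsReduction.succ {k : ℕ} {u : Y} (h : IsReduction K A b (dualTangent K) k u) :
    IsReduction K A b (dualTangent K) (k + 1) u := by
  induction k generalizing u with
  | zero =>
    have h0 : (0 : Y) ∈ ProperCone.innerDual (K : Set Y) := Submodule.zero_mem _
    rw [show u = 0 from h]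
    refine ⟨0, 0, rfl, h0, (mem_tangent_iff h0).2 fun z _ => inner_zero_left z, ?_⟩
    rw [add_zero]
    exact Submodule.zero_mem _
  | succ k ih =>
    obtain ⟨u', v, h', hu⟩ := h
    exact ⟨u', v, ih h', hu⟩

theorem IsReduction.of_le {k l : ℕ} (hkl : k ≤ l) {u : Y}
    (h : IsReduction K A b (dualTangent K) k u) : IsReduction K A b (dualTangent K) l u := by
  induction hkl with
  | refl => exact h
  | step _ ih => exact ih.succ

theorem IsReduction.subset_exposedFace (hF : IsMinimalCone K A b F) {k : ℕ} {u : Y}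
    (h : IsReduction K A b (dualTangent K) k u) : F ⊆ exposedFace K u := by
  induction k generalizing u with
  | zero =>
    rw [show u = 0 from h]
    exact fun z hz => ⟨hF.1.subset hz, inner_zero_left z⟩
  | succ k ih =>
    obtain ⟨u', v, h', hu, hv, hL⟩ := h
    refine hF.subset_face (isFace_exposedFace hu) fun x hx => ⟨hx, ?_⟩
    have h1 := (mem_tangent_iff h'.mem_innerDual).1 hv _ (ih h' (hF.slack_mem hx))
    obtain ⟨h2, h3⟩ := mem_nullL_iff.1 hL
    have h4 : ⟪u + v, b - A x⟫ = 0 := by rw [inner_sub_right, h2, h3, sub_zero]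
    rwa [inner_add_left, h1, add_zero] at h4

theorem isReduction_of_mem_extFeas {l : ℕ} {p : (Fin (l + 2) → Y) × (Fin (l + 2) → Y)}
    (hp : p ∈ extFeas K A b T l) (i : Fin (l + 1)) : IsReduction K A b T i (p.1 i.castSucc) := by
  induction i using Fin.induction with
  | zero => exact hp.1.1
  | succ i ih =>
    have h := hp.2.1 i.castSucc
    exact ⟨_, _, ih, h.1, h.2, hp.2.2 i⟩

/-- The last pair is not required to sum into `L`, so any `u` in the dual cone and `v` in `T u'` can
close a sequence that ends in `u'`. -/
theorem IsReduction.exists_mem_extFeas {l : ℕ} {u' u v : Y} (h : IsReduction K A b T l u')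
    (hu : u ∈ ProperCone.innerDual (K : Set Y)) (hv : v ∈ T u') :
    ∃ p ∈ extFeas K A b T l, p.1 (Fin.last (l + 1)) = u ∧ p.2 (Fin.last (l + 1)) = v := by
  induction l generalizing u' u v with
  | zero =>
    refine ⟨(Fin.cons 0 fun _ => u, Fin.cons 0 fun _ => v), ⟨⟨rfl, rfl⟩, fun i => ?_, fun i => ?_⟩,
      rfl, rfl⟩
    · rw [show u' = 0 from h] at hv
      fin_cases i
      exact ⟨hu, hv⟩
    · exact i.elim0
  | succ l ih =>
    obtain ⟨u'', v', h', hu', hv', hL⟩ := h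
    obtain ⟨p, hp, hpu, hpv⟩ := ih h' hu' hv'
    refine ⟨(Fin.snoc (α := fun _ => Y) p.1 u, Fin.snoc (α := fun _ => Y) p.2 v),
      ⟨⟨hp.1.1, hp.1.2⟩, fun i => ?_, fun i => ?_⟩,
      Fin.snoc_last (α := fun _ => Y) _ _, Fin.snoc_last (α := fun _ => Y) _ _⟩
    · dsimp only
      rw [Fin.snoc_castSucc (α := fun _ => Y)]
      induction i using Fin.lastCases with
      | last =>
        rw [Fin.succ_last, Fin.snoc_last (α := fun _ => Y), Fin.snoc_last (α := fun _ => Y), hpu]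
        exact ⟨hu, hv⟩
      | cast i =>
        rw [Fin.succ_castSucc, Fin.snoc_castSucc (α := fun _ => Y),
          Fin.snoc_castSucc (α := fun _ => Y)]
        exact hp.2.1 i
    · dsimp only
      rw [Fin.snoc_castSucc (α := fun _ => Y), Fin.snoc_castSucc (α := fun _ => Y)]
      induction i using Fin.lastCases with
      | last => rw [Fin.succ_last, hpu, hpv]; exact hL
      | cast i => exact hp.2.2 i

/-- A reduction sequence of length `k` along which the exposed faces strictly decrease. -/
structure IsStrictReduction (K : ProperCone ℝ Y) (A : X →ₗ[ℝ] Y) (b : Y) (k : ℕ) (u : Y) :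
    Prop where
  isReduction : IsReduction K A b (dualTangent K) k u
  exists_add_mem : ∃ v, (∀ z ∈ exposedFace K u, ⟪v, z⟫ = 0) ∧ u + v ∈ nullL A b
  exists_chain : ∃ c : Set (Set Y), (∀ G ∈ c, IsFace (K : Set Y) G) ∧
    IsChain (fun G H => G ⊆ H) c ∧ c.encard = k + 1 ∧ ∀ G ∈ c, exposedFace K u ⊆ G
  le_finrank : k ≤ Module.finrank ℝ
    (nullL A b ⊓ (Submodule.span ℝ (exposedFace K u))ᗮ : Submodule ℝ Y)

theorem IsStrictReduction.zero : IsStrictReduction K A b 0 0 where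
  isReduction := rfl
  exists_add_mem := ⟨0, fun z _ => inner_zero_left z, by
    rw [add_zero]; exact Submodule.zero_mem _⟩
  exists_chain := ⟨{exposedFace K 0}, by
    rintro G rfl
    exact isFace_exposedFace (Submodule.zero_mem _), IsChain.singleton, by simp,
    fun G hG => hG.symm.subset⟩
  le_finrank := Nat.zero_le _

/-- The pairs are accumulated, `(u + u₁, v + v₁)`, so that the new exposed face is exactly `E ∩
y^⊥`. It misses `z₀`, which extends the chain, and `y` joins `L ∩ E^⊥`, which raises the dimension.
-/
theorem IsStrictReduction.succ (hK : IsNice K) (hF : IsMinimalCone K A b F) {k : ℕ} {u : Y}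
    (h : IsStrictReduction K A b k u) (hne : exposedFace K u ≠ F) :
    ∃ u', IsStrictReduction K A b (k + 1) u' := by
  have hu := h.isReduction.mem_innerDual
  have hE := isFace_exposedFace hu
  have hFE : F ⊂ exposedFace K u :=
    (h.isReduction.subset_exposedFace hF).ssubset_of_ne hne.symm
  obtain ⟨y, hyL, hyE, z₀, hz₀, hyz₀⟩ := exists_reducing_direction hF hE hFE
  obtain ⟨u₁, hu₁, v₁, hv₁, rfl⟩ := hK.exists_add_of_mem_innerDual hE (y := y) (by
    intro z hz
    have := hyE z hz
    rwa [real_inner_comm] at this)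
  obtain ⟨v, hv, hL⟩ := h.exists_add_mem
  have hu' : u + u₁ ∈ ProperCone.innerDual (K : Set Y) := cone_add_mem hu hu₁
  have hL' : (u + u₁) + (v + v₁) ∈ nullL A b := by
    convert Submodule.add_mem _ hL hyL using 1
    abel
  have hmem : ∀ z, z ∈ exposedFace K (u + u₁) ↔ z ∈ exposedFace K u ∧ ⟪u₁ + v₁, z⟫ = 0 := by
    intro z
    constructor
    · rintro ⟨hz, hz0⟩
      rw [inner_add_left] at hz0
      have h1 := inner_nonneg_of_mem_innerDual hu hz
      have h2 := inner_nonneg_of_mem_innerDual hu₁ hz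
      have hzE : z ∈ exposedFace K u := ⟨hz, by linarith⟩
      refine ⟨hzE, ?_⟩
      rw [inner_add_left, hv₁ z hzE]
      linarith
    · rintro ⟨hzE, hz0⟩
      rw [inner_add_left, hv₁ z hzE, add_zero] at hz0
      exact ⟨hzE.1, by rw [inner_add_left, hzE.2, hz0, add_zero]⟩
  have hsub : exposedFace K (u + u₁) ⊆ exposedFace K u := fun z hz => ((hmem z).1 hz).1
  have hz₀' : z₀ ∉ exposedFace K (u + u₁) := fun hz => hyz₀ ((hmem z₀).1 hz).2
  have hvE : ∀ z ∈ exposedFace K u, ⟪v + v₁, z⟫ = 0 := fun z hz => by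
    rw [inner_add_left, hv z hz, hv₁ z hz, add_zero]
  refine ⟨u + u₁, ⟨u, v + v₁, h.isReduction, hu', (mem_tangent_iff hu).2 hvE, hL'⟩,
    ⟨v + v₁, fun z hz => hvE z (hsub hz), hL'⟩, ?_, ?_⟩
  · obtain ⟨c, hc, hchain, hcard, hmin⟩ := h.exists_chain
    refine ⟨insert (exposedFace K (u + u₁)) c, ?_, ?_, ?_, ?_⟩
    · rintro G (rfl | hG)
      exacts [isFace_exposedFace hu', hc G hG]
    · exact hchain.insert fun G hG _ => Or.inl (hsub.trans (hmin G hG))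
    · rw [Set.encard_insert_of_notMem, hcard]
      · norm_cast
      · exact fun hG => hz₀' (hmin _ hG hz₀)
    · rintro G (rfl | hG)
      exacts [subset_rfl, hsub.trans (hmin G hG)]
  · refine Nat.succ_le_of_lt (h.le_finrank.trans_lt (Submodule.finrank_lt_finrank_of_lt ?_))
    refine lt_of_le_of_ne (inf_le_inf_left _
      (Submodule.orthogonal_le (Submodule.span_mono hsub))) fun heq => hyz₀ ?_
    have : u₁ + v₁ ∈ nullL A b ⊓ (Submodule.span ℝ (exposedFace K (u + u₁)))ᗮ :=
      ⟨hyL, mem_span_orthogonal_iff.2 fun z hz => ((hmem z).1 hz).2⟩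
    rw [← heq] at this
    exact mem_span_orthogonal_iff.1 this.2 z₀ hz₀

theorem IsStrictReduction.le_ell {k : ℕ} {u : Y} (h : IsStrictReduction K A b k u) :
    k ≤ ell K A b := by
  have h1 : (k : ℕ∞) + 1 ≤ faceChainLength K := by
    obtain ⟨c, hc, hchain, hcard, -⟩ := h.exists_chain
    rw [← hcard]
    exact Set.encard_le_chainHeight_of_isChain _ _ hc hchain
  have h2 : (k : ℕ∞) ≤ (Module.finrank ℝ (nullL A b) : ℕ∞) := by
    exact_mod_cast h.le_finrank.trans (Submodule.finrank_mono inf_le_left)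
  have h3 : (k : ℕ∞) ≤ faceChainLength K - 1 :=
    ENat.le_sub_of_add_le_right (by simp) h1
  -- Passing to natural numbers needs a finite minimum; the dimension of `L` bounds it even if the
  -- chains of faces are unbounded.
  have := ENat.toNat_le_toNat (le_min h3 h2)
    (ne_top_of_le_ne_top (ENat.natCast_ne_top _) (min_le_right _ _))
  simpa [ell] using this

/-- Facial reduction reaches the minimal cone within `ell K A b` steps. -/
theorem exists_isReduction_exposedFace_eq (hK : IsNice K) (hF : IsMinimalCone K A b F) :
    ∃ u, IsReduction K A b (dualTangent K) (ell K A b) u ∧ exposedFace K u = F := by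
  -- If `F` is never exposed at level `ell K A b`, then by padding no strict reduction exposes it,
  -- so every one can be extended, past the bound on their length.
  by_contra! hno
  have : ∀ k, ∃ u, IsStrictReduction K A b k u := by
    intro k
    induction k with
    | zero => exact ⟨0, IsStrictReduction.zero⟩
    | succ k ih =>
      obtain ⟨u, hu⟩ := ih
      exact hu.succ hK hF (hno u (hu.isReduction.of_le hu.le_ell))
  obtain ⟨u, hu⟩ := this (ell K A b + 1)
  exact absurd hu.le_ell (by simp)

/-- The dual of the minimal cone is a projection of the extended system. -/
theorem mem_innerDual_minimalCone_iff (hK : IsNice K) (hT : IsTangentVariant K T)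
    (hF : IsMinimalCone K A b F) {l : ℕ} (hl : ell K A b ≤ l) {y : Y} :
    y ∈ ProperCone.innerDual F ↔ ∃ p ∈ extFeas K A b T l,
      y = p.1 (Fin.last (l + 1)) + p.2 (Fin.last (l + 1)) := by
  constructor
  · intro hy
    obtain ⟨u₀, hu₀, hface⟩ := exists_isReduction_exposedFace_eq hK hF
    obtain ⟨u, hu, v, hv, rfl⟩ := hK.exists_add_of_mem_innerDual hF.1 hy
    rw [← hface] at hv
    -- Since `u₀` exposes `F`, orthogonality to `F` is tangency at `u₀`; only the sequence up to
    -- `u₀` is rescaled, so `u + v` is unchanged.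
    obtain ⟨t, ht, hvt⟩ := hT.scale u₀ hu₀.mem_innerDual v
      ((mem_tangent_iff hu₀.mem_innerDual).2 hv)
    obtain ⟨p, hp, rfl, rfl⟩ := ((hu₀.of_le hl).scale hT ht).exists_mem_extFeas hu hvt
    exact ⟨p, hp, rfl⟩
  · rintro ⟨p, hp, rfl⟩ z hz
    have h := (isReduction_of_mem_extFeas hp (Fin.last l)).mono hT.subset
    obtain ⟨hu, hv⟩ := hp.2.1 (Fin.last l)
    have h1 := (mem_tangent_iff h.mem_innerDual).1 (hT.subset _ h.mem_innerDual hv) z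
      (h.subset_exposedFace hF hz)
    have h2 := inner_nonneg_of_mem_innerDual hu (hF.1.subset hz)
    change 0 ≤ ⟪z, _⟫
    rw [real_inner_comm, inner_add_left]
    rw [Fin.succ_last] at h1 h2
    linarith

end ReductionSequences

/-! ### Strong duality for conic linear programs -/

section StrongDuality

variable {X Y : Type*} [NormedAddCommGroup X] [InnerProductSpace ℝ X] [FiniteDimensional ℝ X]
  [NormedAddCommGroup Y] [InnerProductSpace ℝ Y] [FiniteDimensional ℝ Y]
  {K : ProperCone ℝ Y} {A : X →ₗ[ℝ] Y} {b : Y} {F : Set Y} {T : Y → Set Y}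

theorem inner_le_of_mem_innerDual (hF : IsMinimalCone K A b F) {c : X} {y : Y}
    (hy : y ∈ ProperCone.innerDual F) (hyc : LinearMap.adjoint A y = c) {x : X}
    (hx : x ∈ primalFeas K A b) : ⟪c, x⟫ ≤ ⟪b, y⟫ := by
  have : 0 ≤ ⟪b - A x, y⟫ := hy (hF.slack_mem hx)
  rw [inner_sub_left, real_inner_comm y (A x), ← LinearMap.adjoint_inner_left, hyc] at this
  linarith

/-- A bounded problem has an optimal dual solution in the dual of the minimal cone. -/
theorem exists_dual_solution (hF : IsMinimalCone K A b F) {c : X} {val : ℝ}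
    (hval : IsLUB ((fun x => ⟪c, x⟫) '' primalFeas K A b) val) :
    ∃ y ∈ ProperCone.innerDual F, LinearMap.adjoint A y = c ∧ ⟪b, y⟫ = val := by
  obtain ⟨x₀, hx₀, hs₀⟩ := hF.exists_isCore
  -- Homogenization: `M (x, t) = t b - A x` and `φ (x, t) = t val - ⟪c, x⟫`. A dual solution is a
  -- functional that is nonnegative on `F` and pulls back to `φ` along `M`.
  let M : (X × ℝ) →ₗ[ℝ] Y := (-A).coprod (LinearMap.toSpanSingleton ℝ Y b)
  let φ : (X × ℝ) →ₗ[ℝ] ℝ := (-(innerₗ X c)).coprod (val • LinearMap.id)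
  have hM : ∀ x t, M (x, t) = t • b - A x := fun x t => by simp [M]; abel
  have hφ : ∀ x t, φ (x, t) = t * val - ⟪c, x⟫ := fun x t => by simp [φ]; ring
  have hpos : ∀ q, M q ∈ F → 0 ≤ φ q := by
    rintro ⟨x, t⟩ hq
    rw [hM] at hq
    rw [hφ]
    set β := |t| + 1
    have hβ0 : 0 < β := by positivity
    have hβ : 0 < t + β := by linarith [neg_abs_le t]
    -- If `φ (x, t) < 0`, mixing `x` with a nearly optimal `x'`, whose gap to `val` is below `-φ (x,
    -- t) / β`, gives a feasible point with value above `val`.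
    by_contra! hneg
    obtain ⟨_, ⟨x', hx', rfl⟩, hx'val, -⟩ := hval.exists_between
      (b := val + (t * val - ⟪c, x⟫) / β) (by
        have : (t * val - ⟪c, x⟫) / β < 0 := div_neg_of_neg_of_pos hneg hβ0
        linarith)
    have hmem : (t + β)⁻¹ • (x + β • x') ∈ primalFeas K A b := by
      have : t • b - A x + β • (b - A x') ∈ K :=
        cone_add_mem (hF.1.subset hq) (K.smul_mem hx' hβ0.le)
      have := K.smul_mem this (r := (t + β)⁻¹) (by positivity)
      change b - A _ ∈ K
      convert this using 1
      have hb : b = (t + β)⁻¹ • ((t + β) • b) := by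
        rw [smul_smul, inv_mul_cancel₀ hβ.ne', one_smul]
      nth_rw 1 [hb]
      rw [map_smul, ← smul_sub, map_add, map_smul]
      congr 1
      module
    have hle : ⟪c, (t + β)⁻¹ • (x + β • x')⟫ ≤ val := hval.1 ⟨_, hmem, rfl⟩
    rw [inner_smul_right, inner_add_right, inner_smul_right, inv_mul_le_iff₀ hβ] at hle
    have h3 : (t * val - ⟪c, x⟫) / β * β = t * val - ⟪c, x⟫ := div_mul_cancel₀ _ hβ0.ne'
    have h4 := mul_lt_mul_of_pos_right hx'val hβ0
    rw [add_mul, h3] at h4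
    linarith
  have hker : φ ∈ (LinearMap.ker M).dualAnnihilator := by
    rw [Submodule.mem_dualAnnihilator]
    intro q hq
    have h1 := hpos q (by rw [LinearMap.mem_ker.1 hq]; exact hF.1.zero_mem)
    have h2 := hpos (-q) (by rw [map_neg, LinearMap.mem_ker.1 hq, neg_zero]; exact hF.1.zero_mem)
    rw [map_neg] at h2
    linarith
  rw [← LinearMap.range_dualMap_eq_dualAnnihilator_ker] at hker
  obtain ⟨g₀, hg₀⟩ := hker
  have hg₀' : ∀ q, g₀ (M q) = φ q := fun q => LinearMap.congr_fun hg₀ q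
  -- The cone is enlarged to `F + U^⊥` because the extension theorem requires the cone and the range
  -- of `M` to reach the whole space; on `U` the enlargement adds nothing.
  let U : Submodule ℝ Y := LinearMap.range M ⊔ Submodule.span ℝ F
  let s : PointedCone ℝ Y :=
    { carrier := {y | ∃ z ∈ F, ∃ w ∈ Uᗮ, y = z + w}
      zero_mem' := ⟨0, hF.1.zero_mem, 0, Submodule.zero_mem _, by simp⟩
      add_mem' := by
        rintro _ _ ⟨z, hz, w, hw, rfl⟩ ⟨z', hz', w', hw', rfl⟩
        exact ⟨z + z', hF.1.add_mem hz hz', w + w', Submodule.add_mem _ hw hw', by abel⟩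
      smul_mem' := by
        rintro ⟨r, hr⟩ _ ⟨z, hz, w, hw, rfl⟩
        exact ⟨r • z, hF.1.smul_mem hz hr, r • w, Submodule.smul_mem _ r hw, smul_add r z w⟩ }
  obtain ⟨g, hg, hgs⟩ := riesz_extension s ⟨LinearMap.range M, g₀.domRestrict _⟩ (by
      rintro ⟨_, q, rfl⟩ ⟨z, hz, w, hw, hzw⟩
      change M q = z + w at hzw
      have hwU : w ∈ U := by
        have : w = M q - z := by rw [hzw]; abel
        rw [this]
        exact Submodule.sub_mem _ (Submodule.mem_sup_left ⟨q, rfl⟩)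
          (Submodule.mem_sup_right (Submodule.subset_span hz))
      have hw0 : w = 0 := by
        have : w ∈ U ⊓ Uᗮ := ⟨hwU, hw⟩
        rwa [Submodule.inf_orthogonal_eq_bot] at this
      have hq : M q ∈ F := by
        rw [hw0, add_zero] at hzw
        rwa [hzw]
      change 0 ≤ g₀ (M q)
      rw [hg₀']
      exact hpos q hq) (by
      intro y
      obtain ⟨a, ha, w, hw, rfl⟩ := U.exists_add_mem_mem_orthogonal y
      obtain ⟨m, ⟨q, rfl⟩, f, hf, rfl⟩ := Submodule.mem_sup.1 ha
      obtain ⟨f₁, hf₁, f₂, hf₂, rfl⟩ := hF.1.exists_sub_of_mem_span hf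
      -- The Slater condition relative to `F` enters here: a large multiple of the core slack
      -- absorbs the negative part `-f₂`.
      obtain ⟨r, hr, hrm⟩ := hs₀.2 f₂ hf₂
      refine ⟨⟨r⁻¹ • M (x₀, 1) - M q, ?_⟩,
        r⁻¹ • (b - A x₀ - r • f₂) + f₁, hF.1.add_mem (hF.1.smul_mem hrm (by positivity)) hf₁,
        w, hw, ?_⟩
      · exact Submodule.sub_mem _ (Submodule.smul_mem _ _ ⟨_, rfl⟩) ⟨_, rfl⟩
      · change r⁻¹ • M (x₀, 1) - M q + (M q + (f₁ - f₂) + w) = _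
        rw [hM, one_smul, smul_sub _ (b - A x₀), smul_smul, inv_mul_cancel₀ hr.ne', one_smul]
        module)
  have hgM : ∀ x t, g (t • b - A x) = t * val - ⟪c, x⟫ := by
    intro x t
    rw [← hM, ← hφ, ← hg₀']
    exact hg ⟨M (x, t), _, rfl⟩
  let y := (InnerProductSpace.toDual ℝ Y).symm (LinearMap.toContinuousLinearMap g)
  have hy : ∀ z, ⟪y, z⟫ = g z := fun z => by simp [y]
  refine ⟨y, fun z hz => ?_, ?_, ?_⟩
  · change 0 ≤ ⟪z, y⟫
    rw [real_inner_comm, hy]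
    exact hgs z ⟨z, hz, 0, Submodule.zero_mem _, by simp⟩
  · refine ext_inner_right ℝ fun x => ?_
    rw [LinearMap.adjoint_inner_left, hy]
    have := hgM x 0
    simp only [zero_smul, zero_sub, zero_mul, map_neg] at this
    linarith
  · rw [real_inner_comm, hy]
    simpa using hgM 0 1

/-- Any `l ≥ ell K A b` is allowed, because for semidefinite programs only an upper bound on `ell`
is computed. -/
theorem strongDuality_extDualFeas (hK : IsNice K) (hP : (primalFeas K A b).Nonempty)
    (hT : IsTangentVariant K T) {l : ℕ} (hl : ell K A b ≤ l) (c : X) :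
    StrongDuality (primalFeas K A b) (fun x => ⟪c, x⟫) (extDualFeas K A b c T l)
      (fun p => ⟪b, p.1 (Fin.last (l + 1)) + p.2 (Fin.last (l + 1))⟫) := by
  obtain ⟨F, hF, -⟩ := existsUnique_isMinimalCone hP
  have hproj : ∀ y, y ∈ ProperCone.innerDual F ↔ ∃ p ∈ extFeas K A b T l,
      y = p.1 (Fin.last (l + 1)) + p.2 (Fin.last (l + 1)) :=
    fun y => mem_innerDual_minimalCone_iff hK hT hF hl
  have hweak : ∀ p ∈ extDualFeas K A b c T l, ∀ x ∈ primalFeas K A b,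
      ⟪c, x⟫ ≤ ⟪b, p.1 (Fin.last (l + 1)) + p.2 (Fin.last (l + 1))⟫ := fun p hp x hx =>
    inner_le_of_mem_innerDual hF ((hproj _).2 ⟨p, hp.1, rfl⟩) hp.2 hx
  have hsol : BddAbove ((fun x => ⟪c, x⟫) '' primalFeas K A b) →
      ∃ val, IsLUB ((fun x => ⟪c, x⟫) '' primalFeas K A b) val ∧
        ∃ p ∈ extDualFeas K A b c T l,
          ⟪b, p.1 (Fin.last (l + 1)) + p.2 (Fin.last (l + 1))⟫ = val := by
    intro hb
    have hlub := isLUB_csSup (hP.image _) hb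
    obtain ⟨y, hy, hyc, hyb⟩ := exists_dual_solution hF hlub
    obtain ⟨p, hp, rfl⟩ := (hproj y).1 hy
    exact ⟨_, hlub, p, ⟨hp, hyc⟩, hyb⟩
  refine ⟨⟨fun hb => ?_, ?_⟩, fun hb _ => ?_⟩
  · obtain ⟨_, _, p, hp, _⟩ := hsol hb
    exact ⟨p, hp⟩
  · rintro ⟨p, hp⟩
    refine ⟨⟪b, p.1 (Fin.last (l + 1)) + p.2 (Fin.last (l + 1))⟫, ?_⟩
    rintro _ ⟨x, hx, rfl⟩
    exact hweak p hp x hx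
  · obtain ⟨val, hlub, p, hp, hpv⟩ := hsol hb
    refine ⟨val, hlub, ⟨p, hp, hpv⟩, ?_⟩
    rintro _ ⟨p', hp', rfl⟩
    refine hlub.2 ?_
    rintro _ ⟨x, hx, rfl⟩
    exact hweak p' hp' x hx

end StrongDuality

/-! ### Positive semidefinite matrices -/

section PosSemidef

open Matrix

variable {n : ℕ}

theorem matInner_eq_trace (x z : Matrix (Fin n) (Fin n) ℝ) : matInner x z = (x * zᵀ).trace := by
  simp [matInner, Matrix.trace, Matrix.mul_apply]

theorem matInner_comm (x z : Matrix (Fin n) (Fin n) ℝ) : matInner x z = matInner z x := by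
  simp [matInner, mul_comm]

theorem matInner_neg_left (x z : Matrix (Fin n) (Fin n) ℝ) :
    matInner (-x) z = -matInner x z := by
  simp [matInner]

theorem matInner_sub_left (x y z : Matrix (Fin n) (Fin n) ℝ) :
    matInner (x - y) z = matInner x z - matInner y z := by
  simp [matInner, sub_mul]

theorem matInner_zero_left (z : Matrix (Fin n) (Fin n) ℝ) : matInner 0 z = 0 := by
  simp [matInner]

theorem matInner_conj (P x z : Matrix (Fin n) (Fin n) ℝ) :
    matInner (P * x * Pᵀ) z = matInner x (Pᵀ * z * P) := by
  rw [matInner_eq_trace, matInner_eq_trace, transpose_mul, transpose_mul, transpose_transpose,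
    Matrix.mul_assoc, Matrix.mul_assoc, Matrix.trace_mul_comm, Matrix.mul_assoc, Matrix.mul_assoc]

theorem posSemidef_isSymm {x : Matrix (Fin n) (Fin n) ℝ} (hx : x.PosSemidef) : xᵀ = x := by
  rw [← conjTranspose_eq_transpose_of_trivial]
  exact hx.isHermitian

theorem posSemidef_conj {x : Matrix (Fin n) (Fin n) ℝ} (hx : x.PosSemidef)
    (P : Matrix (Fin n) (Fin n) ℝ) : (Pᵀ * x * P).PosSemidef := by
  rw [← conjTranspose_eq_transpose_of_trivial]
  exact hx.conjTranspose_mul_mul_same P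

theorem posSemidef_conj' {x : Matrix (Fin n) (Fin n) ℝ} (hx : x.PosSemidef)
    (P : Matrix (Fin n) (Fin n) ℝ) : (P * x * Pᵀ).PosSemidef := by
  rw [← conjTranspose_eq_transpose_of_trivial]
  exact hx.mul_mul_conjTranspose_same P

open scoped MatrixOrder in
theorem exists_eq_transpose_mul_self {x : Matrix (Fin n) (Fin n) ℝ} (hx : x.PosSemidef) :
    ∃ B : Matrix (Fin n) (Fin n) ℝ, x = Bᵀ * B := by
  obtain ⟨B, hB⟩ := CStarAlgebra.nonneg_iff_eq_star_mul_self.1 hx.nonneg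
  exact ⟨B, by rw [hB, star_eq_conjTranspose, conjTranspose_eq_transpose_of_trivial]⟩

/-- `G` extends to the whole space a linear section of `B` over its range. -/
theorem exists_generalized_inverse (B : Matrix (Fin n) (Fin n) ℝ) :
    ∃ G : Matrix (Fin n) (Fin n) ℝ, B * G * B = B := by
  let f := Matrix.toLin' B
  obtain ⟨g, hg⟩ := LinearMap.exists_rightInverse_of_surjective f.rangeRestrict
    f.range_rangeRestrict
  obtain ⟨G, hG⟩ := LinearMap.exists_extend g
  refine ⟨LinearMap.toMatrix' G, ?_⟩
  apply Matrix.toLin'.injective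
  rw [Matrix.toLin'_mul, Matrix.toLin'_mul, Matrix.toLin'_toMatrix']
  refine LinearMap.ext fun x => ?_
  have h1 : G (f x) = g (f.rangeRestrict x) := LinearMap.congr_fun hG (f.rangeRestrict x)
  have h2 : f.rangeRestrict (g (f.rangeRestrict x)) = f.rangeRestrict x :=
    LinearMap.congr_fun hg (f.rangeRestrict x)
  change f (G (f x)) = f x
  rw [h1]
  exact congrArg Subtype.val h2

theorem matInner_nonneg {x z : Matrix (Fin n) (Fin n) ℝ} (hx : x.PosSemidef)
    (hz : z.PosSemidef) : 0 ≤ matInner x z := by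
  obtain ⟨B, rfl⟩ := exists_eq_transpose_mul_self hx
  have := (posSemidef_conj' hz B).trace_nonneg
  rwa [matInner_eq_trace, posSemidef_isSymm hz, Matrix.mul_assoc, Matrix.trace_mul_comm]

theorem posSemidef_of_forall_matInner {x : Matrix (Fin n) (Fin n) ℝ} (hx : xᵀ = x)
    (h : ∀ z : Matrix (Fin n) (Fin n) ℝ, z.PosSemidef → 0 ≤ matInner x z) : x.PosSemidef := by
  refine PosSemidef.of_dotProduct_mulVec_nonneg
    (by rwa [IsHermitian, conjTranspose_eq_transpose_of_trivial]) fun v => ?_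
  have hv : matInner x (vecMulVec v (star v)) = star v ⬝ᵥ x *ᵥ v := by
    simp only [matInner, dotProduct, mulVec, vecMulVec_apply, Pi.star_apply, star_trivial,
      Finset.mul_sum]
    exact Finset.sum_congr rfl fun i _ => Finset.sum_congr rfl fun j _ => by ring
  rw [← hv]
  exact h _ (posSemidef_vecMulVec_self_star v)

theorem eq_zero_of_posSemidef_neg {x : Matrix (Fin n) (Fin n) ℝ} (hx : x.PosSemidef)
    (hx' : (-x).PosSemidef) : x = 0 := by
  have h1 := hx.trace_nonneg
  have h2 := hx'.trace_nonneg
  rw [trace_neg] at h2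
  exact hx.trace_eq_zero_iff.1 (by linarith)

/-- For `z = Cᵀ * C` the trace is the squared Frobenius norm of `C * Q`. -/
theorem mul_eq_zero_of_conj_trace_eq_zero {z Q : Matrix (Fin n) (Fin n) ℝ} (hz : z.PosSemidef)
    (h : (Qᵀ * z * Q).trace = 0) : z * Q = 0 := by
  obtain ⟨C, rfl⟩ := exists_eq_transpose_mul_self hz
  have hC : C * Q = 0 := by
    rw [← trace_conjTranspose_mul_self_eq_zero_iff, conjTranspose_eq_transpose_of_trivial,
      transpose_mul, ← h]
    simp only [Matrix.mul_assoc]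
  rw [Matrix.mul_assoc, hC, Matrix.mul_zero]

theorem exists_posSemidef_smul_one_sub {D : Matrix (Fin n) (Fin n) ℝ} (hD : Dᵀ = D) :
    ∃ t : ℝ, 0 < t ∧ (t • (1 : Matrix (Fin n) (Fin n) ℝ) - D).PosSemidef := by
  have hpos : 0 ≤ ∑ i, ∑ j, |D i j| :=
    Finset.sum_nonneg fun i _ => Finset.sum_nonneg fun j _ => abs_nonneg _
  refine ⟨∑ i, ∑ j, |D i j| + 1, by linarith, PosSemidef.of_dotProduct_mulVec_nonneg ?_ ?_⟩
  · rw [IsHermitian, conjTranspose_eq_transpose_of_trivial, transpose_sub, hD, transpose_smul,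
      transpose_one]
  · intro x
    rw [star_trivial, sub_mulVec, dotProduct_sub, smul_mulVec, one_mulVec, dotProduct_smul,
      sub_nonneg, smul_eq_mul]
    have hxx : 0 ≤ x ⬝ᵥ x := Finset.sum_nonneg fun i _ => mul_self_nonneg _
    have hle : ∀ i, x i * x i ≤ x ⬝ᵥ x := fun i =>
      Finset.single_le_sum (f := fun i => x i * x i) (fun i _ => mul_self_nonneg _)
        (Finset.mem_univ i)
    calc x ⬝ᵥ D *ᵥ x = ∑ i, ∑ j, D i j * (x i * x j) := by
          simp only [dotProduct, mulVec, Finset.mul_sum]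
          exact Finset.sum_congr rfl fun i _ => Finset.sum_congr rfl fun j _ => by ring
      _ ≤ ∑ i, ∑ j, |D i j| * (x ⬝ᵥ x) := by
          refine Finset.sum_le_sum fun i _ => Finset.sum_le_sum fun j _ => ?_
          have h1 : |x i * x j| ≤ x ⬝ᵥ x := by
            rw [abs_le]
            constructor <;> nlinarith [hle i, hle j, sq_nonneg (x i - x j), sq_nonneg (x i + x j)]
          calc D i j * (x i * x j) ≤ |D i j * (x i * x j)| := le_abs_self _
            _ = |D i j| * |x i * x j| := abs_mul _ _
            _ ≤ _ := mul_le_mul_of_nonneg_left h1 (abs_nonneg _)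
      _ = (∑ i, ∑ j, |D i j|) * (x ⬝ᵥ x) := by simp only [Finset.sum_mul]
      _ ≤ (∑ i, ∑ j, |D i j| + 1) * (x ⬝ᵥ x) := by nlinarith

/-- Every positive semidefinite matrix `u` has a factorization `u = Bᵀ * B` and a (not necessarily
orthogonal) projection `G * B` along its kernel. -/
theorem exists_factorization {u : Matrix (Fin n) (Fin n) ℝ} (hu : u.PosSemidef) :
    ∃ B G : Matrix (Fin n) (Fin n) ℝ, u = Bᵀ * B ∧ B * G * B = B := by
  obtain ⟨B, hB⟩ := exists_eq_transpose_mul_self hu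
  obtain ⟨G, hG⟩ := exists_generalized_inverse B
  exact ⟨B, G, hB, hG⟩

theorem mul_one_sub_eq_zero {B G : Matrix (Fin n) (Fin n) ℝ} (hG : B * G * B = B) :
    B * (1 - G * B) = 0 := by
  rw [Matrix.mul_sub, Matrix.mul_one, ← Matrix.mul_assoc, hG, sub_self]

/-- The hypothesis gives `z = Bᵀ (Gᵀ z G) B`, so it suffices to dominate `Gᵀ z G` by a multiple of
the identity and conjugate by `B`. -/
theorem exists_posSemidef_smul_sub {B G z : Matrix (Fin n) (Fin n) ℝ} (hz : zᵀ = z)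
    (h : z * (1 - G * B) = 0) : ∃ t : ℝ, 0 < t ∧ (t • (Bᵀ * B) - z).PosSemidef := by
  obtain ⟨t, ht, hp⟩ := exists_posSemidef_smul_one_sub (D := Gᵀ * z * G) (by
    simp [Matrix.mul_assoc, hz])
  refine ⟨t, ht, ?_⟩
  convert posSemidef_conj hp B using 1
  have h1 : z * (G * B) = z := by
    rw [Matrix.mul_sub, Matrix.mul_one, sub_eq_zero] at h
    exact h.symm
  have h2 : (G * B)ᵀ * z = z := by
    have := congrArg transpose h1
    rwa [transpose_mul, hz] at this
  rw [Matrix.mul_sub, Matrix.sub_mul, Matrix.mul_smul, Matrix.smul_mul, Matrix.mul_one]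
  congr 1
  nth_rw 1 [← h2, ← h1]
  simp only [transpose_mul, Matrix.mul_assoc]

/-- The sets `tan'` that give Ramana's dual. -/
def blockTangent (u : Matrix (Fin n) (Fin n) ℝ) : Set (Matrix (Fin n) (Fin n) ℝ) :=
  {v | ∃ w : Matrix (Fin n) (Fin n) ℝ, (fromBlocks u w wᵀ 1).PosSemidef ∧ v = w + wᵀ}

theorem posSemidef_fromBlocks_one_iff {u w : Matrix (Fin n) (Fin n) ℝ} :
    (fromBlocks u w wᵀ 1).PosSemidef ↔ (u - w * wᵀ).PosSemidef := by
  let _ : Invertible (1 : Matrix (Fin n) (Fin n) ℝ) := invertibleOne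
  have := Matrix.PosDef.fromBlocks₂₂ u w (PosDef.one (n := Fin n) (R := ℝ))
  rwa [conjTranspose_eq_transpose_of_trivial, inv_one, Matrix.mul_one] at this

/-- By the Schur complement `w wᵀ ⪯ u`, so `⟨w wᵀ, z⟩ = 0` and hence `z w = 0`. -/
theorem matInner_eq_zero_of_mem_blockTangent {u v z : Matrix (Fin n) (Fin n) ℝ}
    (hv : v ∈ blockTangent u) (hz : z.PosSemidef) (huz : matInner u z = 0) :
    matInner v z = 0 := by
  obtain ⟨w, hw, rfl⟩ := hv
  rw [posSemidef_fromBlocks_one_iff] at hw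
  have h1 := matInner_nonneg hw hz
  have hww : (w * 1 * wᵀ).PosSemidef := posSemidef_conj' PosSemidef.one w
  have h2 := matInner_nonneg hww hz
  rw [matInner_sub_left, huz] at h1
  rw [Matrix.mul_one] at h2
  have h3 : matInner (w * 1 * wᵀ) z = 0 := by rw [Matrix.mul_one]; linarith
  rw [matInner_conj, matInner_eq_trace, Matrix.one_mul, trace_transpose] at h3
  have h4 := mul_eq_zero_of_conj_trace_eq_zero hz h3
  have h5 : wᵀ * z = 0 := by
    have := congrArg transpose h4
    rwa [transpose_mul, posSemidef_isSymm hz, transpose_zero] at this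
  rw [matInner_eq_trace, posSemidef_isSymm hz, Matrix.add_mul, h5, add_zero,
    Matrix.trace_mul_comm, h4, trace_zero]

theorem exists_mem_blockTangent_smul {u v : Matrix (Fin n) (Fin n) ℝ} (hu : u.PosSemidef)
    (hv : vᵀ = v)
    (h : ∀ z : Matrix (Fin n) (Fin n) ℝ, z.PosSemidef → matInner u z = 0 → matInner v z = 0) :
    ∃ t : ℝ, 0 < t ∧ v ∈ blockTangent (t • u) := by
  obtain ⟨B, G, rfl, hG⟩ := exists_factorization hu
  set P := G * B with hP
  set Q := 1 - P with hQ
  have hBQ : B * Q = 0 := mul_one_sub_eq_zero hG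
  have hPQ : P * Q = 0 := by rw [hP, Matrix.mul_assoc, hBQ, Matrix.mul_zero]
  have hQsymm : (Qᵀ * v * Q)ᵀ = Qᵀ * v * Q := by simp [Matrix.mul_assoc, hv]
  -- `Q z Qᵀ` is orthogonal to `u` because `B * Q = 0`; so the hypothesis forces the block of `v` on
  -- the kernel of `u` to vanish.
  have hQ0 : ∀ z : Matrix (Fin n) (Fin n) ℝ, z.PosSemidef → matInner (Qᵀ * v * Q) z = 0 := by
    intro z hz
    have := matInner_conj Qᵀ v z
    rw [transpose_transpose] at this
    rw [this]
    refine h _ (posSemidef_conj' hz Q) ?_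
    have := matInner_conj Qᵀ (Bᵀ * B) z
    rw [transpose_transpose] at this
    rw [← this, Matrix.mul_assoc, Matrix.mul_assoc, hBQ, Matrix.mul_zero, Matrix.mul_zero,
      matInner_zero_left]
  have hvQ : Qᵀ * v * Q = 0 := by
    refine eq_zero_of_posSemidef_neg
      (posSemidef_of_forall_matInner hQsymm fun z hz => (hQ0 z hz).ge)
      (posSemidef_of_forall_matInner (by rw [transpose_neg, hQsymm]) fun z hz => ?_)
    rw [matInner_neg_left, hQ0 z hz, neg_zero]
  -- Half the diagonal block plus one off-diagonal block, so that `w + wᵀ = v - Qᵀ v Q`. As `wᵀ`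
  -- ends in `P` and `P * Q = 0`, a multiple of `u` dominates `w * wᵀ`.
  set w := Pᵀ * ((1 / 2 : ℝ) • (v * P) + v * Q) with hw
  have hwt : wᵀ = ((1 / 2 : ℝ) • (Pᵀ * v) + Qᵀ * v) * P := by
    simp [hw, hv]
  obtain ⟨t, ht, hp⟩ := exists_posSemidef_smul_sub (B := B) (G := G) (z := w * wᵀ)
    (by simp) (by rw [← hP, ← hQ, Matrix.mul_assoc, hwt, Matrix.mul_assoc _ P, hPQ]; simp)
  refine ⟨t, ht, w, posSemidef_fromBlocks_one_iff.2 hp, ?_⟩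
  have hPQ1 : P + Q = 1 := by rw [hQ]; abel
  calc v = (P + Q)ᵀ * v * (P + Q) := by rw [hPQ1]; simp
    _ = Pᵀ * v * P + Pᵀ * v * Q + Qᵀ * v * P + Qᵀ * v * Q := by
      simp only [transpose_add, Matrix.add_mul, Matrix.mul_add]; abel
    _ = w + wᵀ := by
      rw [hvQ, hwt, hw]
      simp only [Matrix.add_mul, Matrix.mul_add, Matrix.smul_mul, Matrix.mul_smul, Matrix.mul_assoc]
      module

end PosSemidef

/-! ### The Euclidean space of symmetric matrices -/

section SymmetricMatrices

open Matrix

variable {n : ℕ}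

/-- The Euclidean space of symmetric `n × n` matrices. -/
abbrev SymMat (n : ℕ) : Submodule ℝ (EuclideanSpace ℝ (Fin n × Fin n)) where
  carrier := {x | ∀ i j, x (i, j) = x (j, i)}
  zero_mem' := fun _ _ => rfl
  add_mem' := fun hx hy i j => by simp [hx i j, hy i j]
  smul_mem' := fun c x hx i j => by simp [hx i j]

/-- The matrix that corresponds to a point of `SymMat n`. -/
def toMat : SymMat n →ₗ[ℝ] Matrix (Fin n) (Fin n) ℝ where
  toFun x := Matrix.of fun i j => x.1 (i, j)
  map_add' _ _ := rfl
  map_smul' _ _ := rfl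

/-- The point of `SymMat n` that corresponds to a symmetric matrix. -/
def ofMat (x : Matrix (Fin n) (Fin n) ℝ) (hx : xᵀ = x) : SymMat n :=
  ⟨WithLp.toLp 2 fun p => x p.1 p.2, fun i j => congrFun (congrFun hx j) i⟩

theorem toMat_transpose (x : SymMat n) : (toMat x)ᵀ = toMat x := by
  ext i j
  exact x.2 j i

@[simp] theorem toMat_ofMat (x : Matrix (Fin n) (Fin n) ℝ) (hx : xᵀ = x) :
    toMat (ofMat x hx) = x := rfl

theorem toMat_injective : Function.Injective (toMat (n := n)) := by
  intro x y h
  ext ⟨i, j⟩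
  exact congrFun (congrFun h i) j

theorem inner_eq_matInner (x y : SymMat n) : ⟪x, y⟫ = matInner (toMat x) (toMat y) := by
  rw [Submodule.coe_inner, PiLp.inner_apply, Fintype.sum_prod_type]
  exact Finset.sum_congr rfl fun i _ => Finset.sum_congr rfl fun j _ => mul_comm _ _

theorem inner_ofMat {x : Matrix (Fin n) (Fin n) ℝ} {hx : xᵀ = x} (y : SymMat n) :
    ⟪ofMat x hx, y⟫ = matInner x (toMat y) := by
  rw [inner_eq_matInner, toMat_ofMat]

theorem finrank_symMat (n : ℕ) : Module.finrank ℝ (SymMat n) = n * (n + 1) / 2 := by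
  let e : SymMat n ≃ₗ[ℝ] (Sym2 (Fin n) → ℝ) :=
    { toFun := fun x => Sym2.lift ⟨fun i j => x.1 (i, j), x.2⟩
      map_add' := fun x y => by
        ext s
        induction s using Sym2.ind with
        | _ i j => rfl
      map_smul' := fun c x => by
        ext s
        induction s using Sym2.ind with
        | _ i j => rfl
      invFun := fun f => ⟨WithLp.toLp 2 fun p => f s(p.1, p.2), fun i j => by
        change f s(i, j) = f s(j, i)
        rw [Sym2.eq_swap]⟩
      left_inv := fun x => rfl
      right_inv := fun f => by
        ext s
        induction s using Sym2.ind with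
        | _ i j => rfl }
  rw [e.finrank_eq, Module.finrank_fintype_fun_eq_card, Sym2.card, Fintype.card_fin,
    Nat.choose_two_right, Nat.add_sub_cancel, mul_comm]

/-! ### The cone of positive semidefinite matrices -/

theorem posSemidef_toMat_iff {y : SymMat n} :
    (toMat y).PosSemidef ↔ ∀ x : Fin n → ℝ, 0 ≤ x ⬝ᵥ toMat y *ᵥ x := by
  constructor
  · intro h x
    simpa using h.dotProduct_mulVec_nonneg x
  · intro h
    refine PosSemidef.of_dotProduct_mulVec_nonneg ?_ fun x => by simpa using h x
    rw [IsHermitian, conjTranspose_eq_transpose_of_trivial, toMat_transpose]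

/-- The cone of positive semidefinite matrices in the space of symmetric matrices. -/
def psdCone (n : ℕ) : ProperCone ℝ (SymMat n) where
  carrier := {y | (toMat y).PosSemidef}
  zero_mem' := by
    change (toMat (0 : SymMat n)).PosSemidef
    rw [map_zero]
    exact PosSemidef.zero
  add_mem' := fun {x y} hx hy => by
    change (toMat (x + y)).PosSemidef
    rw [map_add]
    exact hx.add hy
  smul_mem' := fun c x hx => by
    change (toMat ((c : ℝ) • x)).PosSemidef
    rw [map_smul]
    exact hx.smul c.2
  isClosed' := by
    simp only [posSemidef_toMat_iff, Set.ofPred_forall]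
    have hc : Continuous (toMat (n := n)) := toMat.continuous_of_finiteDimensional
    exact isClosed_iInter fun x => isClosed_le continuous_const
      (continuous_const.dotProduct (hc.matrix_mulVec continuous_const))

theorem mem_psdCone {y : SymMat n} : y ∈ psdCone n ↔ (toMat y).PosSemidef := Iff.rfl

theorem innerDual_psdCone (n : ℕ) :
    ProperCone.innerDual (psdCone n : Set (SymMat n)) = psdCone n := by
  ext y
  constructor
  · intro hy
    refine posSemidef_of_forall_matInner (toMat_transpose y) fun z hz => ?_
    have : 0 ≤ ⟪ofMat z (posSemidef_isSymm hz), y⟫ := hy (x := ofMat z (posSemidef_isSymm hz)) hz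
    rwa [inner_ofMat, matInner_comm] at this
  · intro hy z hz
    change 0 ≤ ⟪z, y⟫
    rw [inner_eq_matInner]
    exact matInner_nonneg hz hy

/-- Compressing by `1 - G * B` kills `Bᵀ * B` and leaves `-s` times a nonnegative trace, which must
therefore be zero. -/
theorem posSemidef_mul_eq_zero_of_core {B G z : Matrix (Fin n) (Fin n) ℝ} (hG : B * G * B = B)
    (hz : z.PosSemidef) {s : ℝ} (hs : 0 < s) (h : (Bᵀ * B - s • z).PosSemidef) :
    z * (1 - G * B) = 0 := by
  refine mul_eq_zero_of_conj_trace_eq_zero hz (le_antisymm ?_ (posSemidef_conj hz _).trace_nonneg)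
  have := (posSemidef_conj h (1 - G * B)).trace_nonneg
  rw [Matrix.mul_sub (1 - G * B)ᵀ, Matrix.sub_mul, Matrix.mul_assoc _ (Bᵀ * B),
    Matrix.mul_assoc Bᵀ, mul_one_sub_eq_zero hG, Matrix.mul_zero, Matrix.mul_zero, zero_sub,
    Matrix.mul_smul, Matrix.smul_mul, trace_neg, trace_smul, smul_eq_mul] at this
  nlinarith

/-- A face of the positive semidefinite cone contains every positive semidefinite matrix whose
kernel contains the kernel of a core element. -/
theorem mem_face_of_mul_eq_zero {E : Set (SymMat n)} (hE : IsFace (psdCone n : Set (SymMat n)) E)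
    {e : SymMat n} (he : e ∈ E) {B G : Matrix (Fin n) (Fin n) ℝ} (hB : toMat e = Bᵀ * B)
    {z : SymMat n} (hz : (toMat z).PosSemidef) (h : toMat z * (1 - G * B) = 0) : z ∈ E := by
  obtain ⟨t, ht, hp⟩ := exists_posSemidef_smul_sub (toMat_transpose z) h
  refine hE.mem_of_add_mem (y := t • e - z) hz ?_ (by simpa using hE.smul_mem he ht.le)
  rw [mem_psdCone, map_sub, map_smul, hB]
  exact hp

/-- The sum is the dual of `E`, which is closed. With `P = G * B` built from a core element, `z P =
z` on `E`, so `y` and `P y Pᵀ` agree there; the latter is psd because `Bᵀ z B ∈ E` for every psd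
`z`. -/
theorem isNice_psdCone (n : ℕ) : IsNice (psdCone n) := by
  intro E hE
  suffices h : (ProperCone.innerDual (psdCone n : Set (SymMat n)) : Set (SymMat n)) +
      (((Submodule.span ℝ E)ᗮ : Submodule ℝ (SymMat n)) : Set (SymMat n)) =
        ProperCone.innerDual E by
    rw [h]
    exact ProperCone.isClosed _
  refine Set.Subset.antisymm ?_ ?_
  · rintro _ ⟨u, hu, v, hv, rfl⟩ z hz
    have h1 := hu (hE.subset hz)
    have h2 := mem_span_orthogonal_iff.1 hv z hz
    change 0 ≤ ⟪z, u + v⟫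
    rw [inner_add_right, real_inner_comm v z, h2, add_zero]
    exact h1
  · intro y hy
    obtain ⟨e, he, hcore⟩ := hE.exists_isCore
    obtain ⟨B, G, hB, hG⟩ := exists_factorization (hE.subset he)
    have hzero : ∀ z ∈ E, toMat z * (1 - G * B) = 0 := by
      intro z hz
      obtain ⟨s, hs, hm⟩ := hcore z hz
      have := hE.subset hm
      refine posSemidef_mul_eq_zero_of_core hG (hE.subset hz) hs ?_
      rw [← hB, ← map_smul, ← map_sub]
      exact this
    set P := G * B with hP
    have hpsd : (B * toMat y * Bᵀ).PosSemidef := by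
      refine posSemidef_of_forall_matInner
        (by simp [Matrix.mul_assoc, toMat_transpose]) fun z hz => ?_
      rw [matInner_conj]
      have hz' := posSemidef_conj hz B
      have hmem : ofMat _ (posSemidef_isSymm hz') ∈ E := by
        refine mem_face_of_mul_eq_zero (G := G) hE he hB hz' ?_
        rw [toMat_ofMat, Matrix.mul_assoc, mul_one_sub_eq_zero hG, Matrix.mul_zero]
      have : 0 ≤ ⟪ofMat _ (posSemidef_isSymm hz'), y⟫ := hy hmem
      rwa [inner_ofMat, matInner_comm] at this
    have hp : (P * toMat y * Pᵀ).PosSemidef := by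
      convert posSemidef_conj' hpsd G using 1
      simp [hP, Matrix.mul_assoc]
    refine ⟨ofMat _ (posSemidef_isSymm hp), ?_, y - ofMat _ (posSemidef_isSymm hp),
      mem_span_orthogonal_iff.2 fun z hz => ?_, by simp⟩
    · rw [innerDual_psdCone]
      exact hp
    · have h1 : toMat z * P = toMat z := by
        have := hzero z hz
        rw [Matrix.mul_sub, Matrix.mul_one, sub_eq_zero] at this
        exact this.symm
      have h2 : Pᵀ * toMat z = toMat z := by
        have := congrArg transpose h1
        rwa [transpose_mul, toMat_transpose] at this
      rw [inner_sub_left, inner_ofMat, matInner_conj, h2, h1, inner_eq_matInner, sub_self]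

/-- The sets `tan'` that give Ramana's dual, in the space of symmetric matrices. -/
def symBlockTangent (u : SymMat n) : Set (SymMat n) := {v | toMat v ∈ blockTangent (toMat u)}

theorem isTangentVariant_symBlockTangent (n : ℕ) :
    IsTangentVariant (psdCone n) symBlockTangent where
  subset u hu v hv := by
    refine (mem_tangent_iff hu).2 fun z hz => ?_
    have h := hz.2
    rw [inner_eq_matInner] at h ⊢
    exact matInner_eq_zero_of_mem_blockTangent hv hz.1 h
  scale u hu v hv := by
    have h := (mem_tangent_iff hu).1 hv
    rw [innerDual_psdCone] at hu
    obtain ⟨t, ht, hm⟩ := exists_mem_blockTangent_smul hu (toMat_transpose v) (by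
      intro z hz huz
      have := h (ofMat z (posSemidef_isSymm hz)) ⟨hz, by rwa [inner_eq_matInner]⟩
      rwa [inner_eq_matInner] at this)
    refine ⟨t, ht, ?_⟩
    change toMat v ∈ blockTangent (toMat (t • u))
    rwa [map_smul]

/-! ### Chains of faces of the positive semidefinite cone -/

/-- The common kernel of a set of symmetric matrices. -/
def commonKer (E : Set (SymMat n)) : Submodule ℝ (Fin n → ℝ) where
  carrier := {x | ∀ z ∈ E, toMat z *ᵥ x = 0}
  zero_mem' := fun z _ => mulVec_zero _
  add_mem' := fun hx hy z hz => by rw [mulVec_add, hx z hz, hy z hz, add_zero]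
  smul_mem' := fun c x hx z hz => by rw [mulVec_smul, hx z hz, smul_zero]

theorem commonKer_anti {E F : Set (SymMat n)} (h : E ⊆ F) : commonKer F ≤ commonKer E :=
  fun _ hx z hz => hx z (h hz)

/-- The kernel of a core element is the common kernel of its face, and this kernel determines the
face. -/
theorem subset_of_commonKer_le {E F : Set (SymMat n)}
    (hE : IsFace (psdCone n : Set (SymMat n)) E) (hF : IsFace (psdCone n : Set (SymMat n)) F)
    (h : commonKer E ≤ commonKer F) : F ⊆ E := by
  obtain ⟨e, he, hcore⟩ := hE.exists_isCore
  obtain ⟨B, G, hB, hG⟩ := exists_factorization (hE.subset he)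
  intro z hz
  refine mem_face_of_mul_eq_zero (G := G) hE he hB (hF.subset hz) ?_
  have hker : ∀ x, (1 - G * B) *ᵥ x ∈ commonKer E := by
    intro x y hy
    obtain ⟨s, hs, hm⟩ := hcore y hy
    have := posSemidef_mul_eq_zero_of_core (B := B) (z := toMat y) hG (hE.subset hy) hs (by
      rw [← hB, ← map_smul, ← map_sub]
      exact hE.subset hm)
    rw [mulVec_mulVec, this, zero_mulVec]
  apply Matrix.toLin'.injective
  refine LinearMap.ext fun x => ?_
  rw [Matrix.toLin'_apply, ← mulVec_mulVec, h (hker x) z hz, map_zero]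
  rfl

/-- Along a chain the dimension of the common kernel is injective, with values in `0, …, n`. -/
theorem faceChainLength_psdCone_le (n : ℕ) : faceChainLength (psdCone n) ≤ n + 1 := by
  refine iSup_le ?_
  rintro ⟨c, hc, hchain⟩
  let d : Set (SymMat n) → ℕ := fun E => Module.finrank ℝ (commonKer E)
  have hinj : Set.InjOn d c := by
    have key : ∀ E ∈ c, ∀ F ∈ c, E ⊆ F → d E = d F → E = F := by
      intro E hE F hF hEF hd
      refine hEF.antisymm (subset_of_commonKer_le (hc hE) (hc hF) ?_)
      exact (Submodule.eq_of_le_of_finrank_eq (commonKer_anti hEF) hd.symm).ge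
    intro E hE F hF hd
    by_contra hne
    rcases hchain hE hF hne with h | h
    · exact hne (key E hE F hF h hd)
    · exact hne (key F hF E hE h hd.symm).symm
  rw [← hinj.encard_image]
  have hsub : d '' c ⊆ (Finset.range (n + 1) : Set ℕ) := by
    rintro _ ⟨E, _, rfl⟩
    rw [Finset.coe_range, Set.mem_Iio, Nat.lt_succ_iff]
    simpa using Submodule.finrank_le (commonKer E)
  refine (Set.encard_le_encard hsub).trans ?_
  rw [Set.encard_coe_eq_coe_finsetCard, Finset.card_range]
  norm_cast

end SymmetricMatrices

/-! ### Semidefinite programs as conic linear programs -/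

section SemidefinitePrograms

open Matrix

/-- Strong duality depends only on the sets of attained values, so problems in different variables
can be compared. -/
theorem StrongDuality.of_image_eq {α α' β β' : Type*} {P : Set α} {P' : Set α'} {f : α → ℝ}
    {f' : α' → ℝ} {D : Set β} {D' : Set β'} {g : β → ℝ} {g' : β' → ℝ}
    (h : StrongDuality P f D g) (hf : f '' P = f' '' P') (hg : g '' D = g' '' D') :
    StrongDuality P' f' D' g' := by
  have hD : D.Nonempty ↔ D'.Nonempty := by
    rw [← Set.image_nonempty (f := g), hg, Set.image_nonempty]
  unfold StrongDuality at h ⊢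
  rwa [← hf, ← hg, ← hD]

variable {n m : ℕ} {a : Fin m → Matrix (Fin n) (Fin n) ℝ} {b : Matrix (Fin n) (Fin n) ℝ}

/-- The linear map `x ↦ ∑ j, x j • a j` of a semidefinite program. -/
def sdpMap (a : Fin m → Matrix (Fin n) (Fin n) ℝ) (ha : ∀ j, (a j)ᵀ = a j) :
    EuclideanSpace ℝ (Fin m) →ₗ[ℝ] SymMat n where
  toFun x := ∑ j, x j • ofMat (a j) (ha j)
  map_add' x y := by simp [add_smul, Finset.sum_add_distrib]
  map_smul' c x := by simp [mul_smul, Finset.smul_sum]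

theorem toMat_sdpMap (ha : ∀ j, (a j)ᵀ = a j) (x : EuclideanSpace ℝ (Fin m)) :
    toMat (sdpMap a ha x) = ∑ j, x j • a j := by
  simp [sdpMap, map_sum]

theorem adjoint_sdpMap (ha : ∀ j, (a j)ᵀ = a j) (y : SymMat n) :
    LinearMap.adjoint (sdpMap a ha) y = WithLp.toLp 2 fun j => matInner (a j) (toMat y) := by
  refine ext_inner_right ℝ fun x => ?_
  rw [LinearMap.adjoint_inner_left, PiLp.inner_apply]
  simp only [sdpMap, LinearMap.coe_mk, AddHom.coe_mk, inner_sum]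
  refine Finset.sum_congr rfl fun j _ => ?_
  refine (real_inner_smul_right y (ofMat (a j) (ha j)) (x j)).trans ?_
  rw [real_inner_comm (ofMat (a j) (ha j)) y, inner_ofMat]
  rfl

theorem adjoint_sdpMap_eq_iff (ha : ∀ j, (a j)ᵀ = a j) {y : SymMat n} {c : Fin m → ℝ} :
    LinearMap.adjoint (sdpMap a ha) y = WithLp.toLp 2 c ↔
      ∀ j, matInner (a j) (toMat y) = c j := by
  rw [adjoint_sdpMap, (WithLp.toLp_injective 2).eq_iff, funext_iff]

theorem mem_nullL_sdpMap_iff (ha : ∀ j, (a j)ᵀ = a j) (hb : bᵀ = b) {y : SymMat n} :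
    y ∈ nullL (sdpMap a ha) (ofMat b hb) ↔
      (∀ j, matInner (a j) (toMat y) = 0) ∧ matInner b (toMat y) = 0 := by
  rw [nullL, Submodule.mem_inf, LinearMap.mem_ker, LinearMap.mem_ker, innerₗ_apply_apply,
    inner_ofMat]
  exact and_congr_left fun _ => adjoint_sdpMap_eq_iff ha (c := fun _ => 0)

/-- `L` is the orthogonal complement, among symmetric matrices, of the span of `b` and the `a j`. -/
theorem finrank_span_add_finrank_nullL (ha : ∀ j, (a j)ᵀ = a j) (hb : bᵀ = b) :
    Module.finrank ℝ (Submodule.span ℝ (insert b (Set.range a))) +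
      Module.finrank ℝ (nullL (sdpMap a ha) (ofMat b hb)) = n * (n + 1) / 2 := by
  let S : Set (SymMat n) := insert (ofMat b hb) (Set.range fun j => ofMat (a j) (ha j))
  have hS : toMat '' S = insert b (Set.range a) := by
    rw [Set.image_insert_eq, ← Set.range_comp]
    rfl
  have hnull : nullL (sdpMap a ha) (ofMat b hb) = (Submodule.span ℝ S)ᗮ := by
    ext y
    rw [mem_nullL_sdpMap_iff, mem_span_orthogonal_iff, Set.forall_mem_insert, Set.forall_mem_range,
      and_comm]
    simp only [← inner_ofMat (hx := hb), ← inner_ofMat (hx := ha _), real_inner_comm y]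
  rw [← hS, ← Submodule.map_span, hnull, ← finrank_symMat n,
    ← Submodule.finrank_add_finrank_orthogonal (Submodule.span ℝ S),
    (Submodule.equivMapOfInjective toMat toMat_injective (Submodule.span ℝ S)).finrank_eq]

theorem ell_sdpMap_le (ha : ∀ j, (a j)ᵀ = a j) (hb : bᵀ = b) :
    ell (psdCone n) (sdpMap a ha) (ofMat b hb) ≤ min n (n * (n + 1) / 2 -
      Module.finrank ℝ (Submodule.span ℝ (insert b (Set.range a)))) := by
  rw [← finrank_span_add_finrank_nullL ha hb, Nat.add_sub_cancel_left]
  have h : faceChainLength (psdCone n) - 1 ≤ (n : ℕ∞) :=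
    tsub_le_iff_right.2 (faceChainLength_psdCone_le n)
  exact le_min (ENat.toNat_le_of_le_natCast ((min_le_left _ _).trans h))
    (ENat.toNat_le_of_le_natCast (min_le_right _ _))

theorem image_primalFeas_sdpMap (ha : ∀ j, (a j)ᵀ = a j) (hb : bᵀ = b) (c : Fin m → ℝ) :
    (fun x => ⟪WithLp.toLp 2 c, x⟫) '' primalFeas (psdCone n) (sdpMap a ha) (ofMat b hb) =
      (fun x => ∑ j, c j * x j) '' sdpFeas a b := by
  have hmem : ∀ x : EuclideanSpace ℝ (Fin m),
      x ∈ primalFeas (psdCone n) (sdpMap a ha) (ofMat b hb) ↔ (x : Fin m → ℝ) ∈ sdpFeas a b := by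
    intro x
    change (toMat _).PosSemidef ↔ _
    rw [map_sub, toMat_sdpMap]
    rfl
  have hinner : ∀ x : EuclideanSpace ℝ (Fin m), ⟪WithLp.toLp 2 c, x⟫ = ∑ j, c j * x j := by
    intro x
    rw [PiLp.inner_apply]
    exact Finset.sum_congr rfl fun j _ => mul_comm _ _
  ext r
  constructor
  · rintro ⟨x, hx, rfl⟩
    exact ⟨x, (hmem x).1 hx, (hinner x).symm⟩
  · rintro ⟨x, hx, rfl⟩
    exact ⟨WithLp.toLp 2 x, (hmem _).2 hx, hinner _⟩

variable {l : ℕ} {c : Fin m → ℝ}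

/-- First link of a cycle of three inclusions that identifies the value sets of the conic extended
dual, Ramana's dual and the dual with variables `v`. -/
theorem image_extDualFeas_subset_ramana (ha : ∀ j, (a j)ᵀ = a j) (hb : bᵀ = b) :
    (fun p => ⟪ofMat b hb, p.1 (Fin.last (l + 1)) + p.2 (Fin.last (l + 1))⟫) ''
        extDualFeas (psdCone n) (sdpMap a ha) (ofMat b hb) (WithLp.toLp 2 c) symBlockTangent l ⊆
      (fun p => matInner b (p.y (Fin.last l))) '' {p : RamanaVars n l | p.IsFeasible a b c} := by
  rintro _ ⟨p, ⟨⟨⟨hu0, hv0⟩, hT, hL⟩, hobj⟩, rfl⟩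
  choose hu w hw hv using hT
  have hy : ∀ i : Fin (l + 1), RamanaVars.y ⟨fun i => toMat (p.1 i), w⟩ i =
      toMat (p.1 i.succ + p.2 i.succ) := fun i => by rw [map_add, hv i]; rfl
  refine ⟨⟨fun i => toMat (p.1 i), w⟩, ⟨fun j => ?_, fun i => ?_, fun i => ?_, hw, ?_⟩, ?_⟩
  · rw [hy]
    exact (adjoint_sdpMap_eq_iff ha).1 hobj j
  · simp only [hy]
    exact (mem_nullL_sdpMap_iff ha hb).1 (hL i)
  · have := hu i
    rwa [innerDual_psdCone] at this
  · change toMat (p.1 0) = 0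
    rw [hu0, map_zero]
  · change matInner b (RamanaVars.y _ _) = _
    rw [hy]
    exact (inner_ofMat _).symm

theorem image_ramana_subset_sdpDual :
    (fun p => matInner b (p.y (Fin.last l))) '' {p : RamanaVars n l | p.IsFeasible a b c} ⊆
      (fun p => matInner b (p.u (Fin.last (l + 1)) + p.v (Fin.last (l + 1)))) ''
        {p : SDPDualVars n l | p.IsFeasible a b c} := by
  rintro _ ⟨p, hp, rfl⟩
  exact ⟨⟨p.u, Fin.cons 0 fun i => p.w i + (p.w i)ᵀ, p.w⟩,
    ⟨hp.objective, hp.null, hp.psd, hp.block, fun i => rfl, hp.zero, rfl⟩, rfl⟩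

theorem image_sdpDual_subset_extDualFeas (ha : ∀ j, (a j)ᵀ = a j) (hb : bᵀ = b) :
    (fun p => matInner b (p.u (Fin.last (l + 1)) + p.v (Fin.last (l + 1)))) ''
        {p : SDPDualVars n l | p.IsFeasible a b c} ⊆
      (fun p => ⟪ofMat b hb, p.1 (Fin.last (l + 1)) + p.2 (Fin.last (l + 1))⟫) ''
        extDualFeas (psdCone n) (sdpMap a ha) (ofMat b hb) (WithLp.toLp 2 c)
          symBlockTangent l := by
  rintro _ ⟨p, hp, rfl⟩
  -- Symmetry of `u` and `v` is not a separate constraint; it follows from semidefiniteness and from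
  -- `v = w + wᵀ`.
  have hu : ∀ i, (p.u i)ᵀ = p.u i := by
    refine Fin.cases ?_ fun i => posSemidef_isSymm (hp.psd i)
    rw [hp.zero.1, transpose_zero]
  have hv : ∀ i, (p.v i)ᵀ = p.v i := by
    refine Fin.cases ?_ fun i => ?_
    · rw [hp.zero.2, transpose_zero]
    · rw [hp.v_eq, transpose_add, transpose_transpose, add_comm]
  refine ⟨(fun i => ofMat _ (hu i), fun i => ofMat _ (hv i)),
    ⟨⟨⟨toMat_injective ?_, toMat_injective ?_⟩, fun i => ⟨?_, p.w i, hp.block i, hp.v_eq i⟩,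
      fun i => (mem_nullL_sdpMap_iff ha hb).2 (hp.null i)⟩,
      (adjoint_sdpMap_eq_iff ha).2 hp.objective⟩, inner_ofMat _⟩
  · rw [map_zero]; exact hp.zero.1
  · rw [map_zero]; exact hp.zero.2
  · rw [innerDual_psdCone]; exact hp.psd i

end SemidefinitePrograms

end ConicDuality

end

open ConicDuality in
theorem corollary3 :
    -- conic linear programs over nice cones
    (∀ (X Y : Type*) [NormedAddCommGroup X] [InnerProductSpace ℝ X] [FiniteDimensional ℝ X]
      [NormedAddCommGroup Y] [InnerProductSpace ℝ Y] [FiniteDimensional ℝ Y]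
      (K : ProperCone ℝ Y) (A : X →ₗ[ℝ] Y) (b : Y) (T : Y → Set Y),
      IsNice K → (primalFeas K A b).Nonempty → IsTangentVariant K T →
        -- the minimal cone is well defined, and its dual is a projection of the extended system
        (∃! F : Set Y, IsMinimalCone K A b F) ∧
        (∀ F : Set Y, IsMinimalCone K A b F →
          (ProperCone.innerDual F : Set Y) =
            {y | ∃ p ∈ extFeas K A b T (ell K A b),
              y = p.1 (Fin.last (ell K A b + 1)) + p.2 (Fin.last (ell K A b + 1))}) ∧
        -- the extended dual has strong duality with the primal
        (∀ c : X, StrongDuality (primalFeas K A b) (fun x => inner ℝ c x)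
          (extDualFeas K A b c T (ell K A b))
          (fun p => inner ℝ b
            (p.1 (Fin.last (ell K A b + 1)) + p.2 (Fin.last (ell K A b + 1)))))) ∧
    -- semidefinite programs
    (∀ (n m : ℕ) (a : Fin m → Matrix (Fin n) (Fin n) ℝ) (b : Matrix (Fin n) (Fin n) ℝ)
      (c : Fin m → ℝ) (l : ℕ),
      (∀ j, (a j).IsSymm) → b.IsSymm → (sdpFeas a b).Nonempty →
      l = min n (n * (n + 1) / 2 -
        Module.finrank ℝ (Submodule.span ℝ (insert b (Set.range a)))) →
        (LinearIndependent ℝ (Fin.cons b a : Fin (m + 1) → Matrix (Fin n) (Fin n) ℝ) →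
          (l : ℤ) = min (n : ℤ) ((n : ℤ) * (n + 1) / 2 - m - 1)) ∧
        StrongDuality (sdpFeas a b) (fun x => ∑ j, c j * x j)
          {p : SDPDualVars n l | p.IsFeasible a b c}
          (fun p => matInner b (p.u (Fin.last (l + 1)) + p.v (Fin.last (l + 1)))) ∧
        StrongDuality (sdpFeas a b) (fun x => ∑ j, c j * x j)
          {p : RamanaVars n l | p.IsFeasible a b c}
          (fun p => matInner b (p.y (Fin.last l)))) := by
  refine ⟨?_, ?_⟩
  · intro X Y _ _ _ _ _ _ K A b T hK hP hT
    refine ⟨existsUnique_isMinimalCone hP, fun F hF => ?_,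
      strongDuality_extDualFeas hK hP hT le_rfl⟩
    ext y
    exact mem_innerDual_minimalCone_iff hK hT hF le_rfl
  · intro n m a b c l ha hb hP hl
    have hl' : ell (psdCone n) (sdpMap a ha) (ofMat b hb) ≤ l := hl ▸ ell_sdpMap_le ha hb
    have hP' : (primalFeas (psdCone n) (sdpMap a ha) (ofMat b hb)).Nonempty := by
      rw [← Set.image_nonempty, image_primalFeas_sdpMap ha hb c, Set.image_nonempty]
      exact hP
    have hdual := strongDuality_extDualFeas (isNice_psdCone n) hP'
      (isTangentVariant_symBlockTangent n) hl' (WithLp.toLp 2 c)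
    have h₁ := image_extDualFeas_subset_ramana (l := l) (c := c) ha hb
    have h₂ := image_ramana_subset_sdpDual (a := a) (b := b) (l := l) (c := c)
    have h₃ := image_sdpDual_subset_extDualFeas (l := l) (c := c) ha hb
    refine ⟨fun hli => ?_,
      hdual.of_image_eq (image_primalFeas_sdpMap ha hb c) ((h₁.trans h₂).antisymm h₃),
      hdual.of_image_eq (image_primalFeas_sdpMap ha hb c) (h₁.antisymm (h₂.trans h₃))⟩
    have hrank := finrank_span_eq_card hli
    rw [Fin.range_cons, Fintype.card_fin] at hrank
    -- This identity gives `m + 1 ≤ n (n + 1) / 2`, so the truncated subtraction agrees with the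
    -- integer one.
    have hdim := finrank_span_add_finrank_nullL ha hb
    rw [hrank] at hl hdim
    have hcast : (n : ℤ) * (n + 1) / 2 = ((n * (n + 1) / 2 : ℕ) : ℤ) := by push_cast; rfl
    rw [hcast, hl]
    omega
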